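/- Let $\Lambda$ be a (not necessarily commutative) left and right Noetherian ring. A finitely generated left $\Lambda$-module $M$ is called reflexive if the evaluation map $M\to M^{**}=\operatorname{Hom}_{\Lambda^{\mathrm{op}}}(\operatorname{Hom}_\Lambda(M,\Lambda),\Lambda)$ is an isomorphism; let $\operatorname{refl}\Lambda$ be the full subcategory of the category of left $\Lambda$-modules consisting of the reflexive modules. Let $0\to\Lambda\to I^0\to I^1\to\cdots$ be the minimal injective resolution of $\Lambda$ as a left $\Lambda$-module. For positive integers $l,n$, one says that $\Lambda$ satisfies the $(l,n)$-condition if the flat dimension of $I^i$ is less than $l$ for all $0\le i<n$. The dominant dimension $\operatorname{dom.dim}\Lambda\in\mathbb{N}\cup\{\infty\}$ is the supremum of the integers $n\geq 0$ such that $I^0,\dots,I^{n-1}$ are flat. Then the category $\operatorname{refl}\Lambda$ is abelian if and only if $\Lambda$ satisfies the $(1,2)$-condition. Moreover, the $(1,2)$-condition holds if and only if $\operatorname{dom.dim}\Lambda\geq 2$. -/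

import Mathlib

open CategoryTheory TensorProduct MulOpposite

universe u

section Reflexive

variable (Λ : Type u) [Ring Λ] (M : Type u) [AddCommGroup M] [Module Λ M]

/-- The dual `M^* = Hom_Λ(M, Λ)` of a left `Λ`-module `M`. It is a right `Λ`-module, that is, a
left module over `Λᵐᵒᵖ`, through `(f • a) m = f m * a`. -/
abbrev RingDual : Type u := M →ₗ[Λ] Λ

/-- The double dual `M^** = Hom_{Λᵐᵒᵖ}(M^*, Λ)`. It is a left `Λ`-module through
`(a • φ) f = a * φ f`. -/
abbrev RingDoubleDual : Type u := RingDual Λ M →ₗ[Λᵐᵒᵖ] Λ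

/-- The evaluation map `M → M^**`, sending `m` to `f ↦ f m`. -/
def evalDoubleDual : M →ₗ[Λ] RingDoubleDual Λ M where
  toFun m :=
    { toFun := fun f => f m
      map_add' := fun _ _ => rfl
      map_smul' := fun _ _ => rfl }
  map_add' m m' := by
    ext f
    exact map_add f m m'
  map_smul' a m := by
    ext f
    exact map_smul f a m

/-- A reflexive module: finitely generated, and the evaluation map `M → M^**` is bijective. -/
def IsReflexiveModule : Prop :=
  Module.Finite Λ M ∧ Function.Bijective (evalDoubleDual Λ M)

/-- The category `refl Λ`: the full subcategory of the category of left `Λ`-modules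
on the reflexive modules. -/
abbrev ReflCat : Type (u + 1) :=
  ObjectProperty.FullSubcategory
    (fun M : ModuleCat.{u} Λ => IsReflexiveModule Λ M)

end Reflexive

section Flat

variable (Λ : Type u) [Ring Λ]

/-- The relations `x a ⊗ m = x ⊗ a m` in `X ⊗_ℤ M`, for a right `Λ`-module `X` (a left
`Λᵐᵒᵖ`-module) and a left `Λ`-module `M`. -/
def balancedRelations (X M : Type u) [AddCommGroup X] [Module Λᵐᵒᵖ X]
    [AddCommGroup M] [Module Λ M] : AddSubgroup (X ⊗[ℤ] M) :=
  AddSubgroup.closure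
    {t | ∃ (x : X) (a : Λ) (m : M), t = (op a • x) ⊗ₜ[ℤ] m - x ⊗ₜ[ℤ] (a • m)}

/-- The tensor product `X ⊗_Λ M` of a right and a left module over a possibly noncommutative
ring `Λ`, as an abelian group. -/
abbrev BalancedTensor (X M : Type u) [AddCommGroup X] [Module Λᵐᵒᵖ X]
    [AddCommGroup M] [Module Λ M] : Type u :=
  (X ⊗[ℤ] M) ⧸ balancedRelations Λ X M

/-- The map `f ⊗ M : X ⊗_Λ M → Y ⊗_Λ M` induced by a homomorphism `f : X → Y` of right
modules. -/
def BalancedTensor.map {X Y : Type u} [AddCommGroup X] [Module Λᵐᵒᵖ X]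
    [AddCommGroup Y] [Module Λᵐᵒᵖ Y] (f : X →ₗ[Λᵐᵒᵖ] Y)
    (M : Type u) [AddCommGroup M] [Module Λ M] :
    BalancedTensor Λ X M →+ BalancedTensor Λ Y M :=
  QuotientAddGroup.map (balancedRelations Λ X M) (balancedRelations Λ Y M)
    (LinearMap.rTensor M f.toAddMonoidHom.toIntLinearMap).toAddMonoidHom (by
      refine (AddSubgroup.closure_le _).2 ?_
      rintro _ ⟨x, a, m, rfl⟩
      refine AddSubgroup.subset_closure ⟨f x, a, m, ?_⟩
      rw [map_sub, ← map_smul f]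
      rfl)

/-- A left `Λ`-module `M` is flat if `- ⊗_Λ M` preserves injections of right modules. -/
def IsFlatModule (M : Type u) [AddCommGroup M] [Module Λ M] : Prop :=
  ∀ (X Y : Type u) [AddCommGroup X] [Module Λᵐᵒᵖ X] [AddCommGroup Y] [Module Λᵐᵒᵖ Y]
    (f : X →ₗ[Λᵐᵒᵖ] Y), Function.Injective f →
      Function.Injective (BalancedTensor.map Λ f M)

/-- `HasFlatDimLT Λ l M` says that the flat dimension of `M` is less than `l`: there is an exact
sequence `0 → F_{l-1} → ⋯ → F_0 → M → 0` with all `F_i` flat (and `M = 0` if `l = 0`). -/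
def HasFlatDimLT : ℕ → ModuleCat.{u} Λ → Prop
  | 0, M => Subsingleton M
  | l + 1, M => ∃ (K F : ModuleCat.{u} Λ) (i : K →ₗ[Λ] F) (p : F →ₗ[Λ] M),
      IsFlatModule Λ F ∧ Function.Injective i ∧ Function.Exact i p ∧
        Function.Surjective p ∧ HasFlatDimLT l K

end Flat

section Resolution

variable (Λ : Type u) [Ring Λ]

/-- A submodule is essential if it meets every nonzero submodule nontrivially. -/
def IsEssentialSubmodule {M : Type u} [AddCommGroup M] [Module Λ M] (N : Submodule Λ M) : Prop :=
  ∀ L : Submodule Λ M, N ⊓ L = ⊥ → L = ⊥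

/-- A minimal injective resolution `0 → M → I⁰ → I¹ → ⋯`: an exact sequence in which every `Iⁿ` is
injective, `I⁰` is an essential extension of the image of `M`, and `Iⁿ⁺¹` is an essential extension
of the image of `Iⁿ`. It exists for every `M` and is unique up to isomorphism. -/
structure MinimalInjectiveResolution (M : Type u) [AddCommGroup M] [Module Λ M] where
  I : ℕ → ModuleCat.{u} Λ
  ι : M →ₗ[Λ] I 0
  d : ∀ n : ℕ, I n →ₗ[Λ] I (n + 1)
  injective : ∀ n : ℕ, Module.Injective Λ (I n)
  ι_injective : Function.Injective ι
  exact_zero : Function.Exact ι (d 0)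
  exact_succ : ∀ n : ℕ, Function.Exact (d n) (d (n + 1))
  essential_zero : IsEssentialSubmodule Λ (LinearMap.range ι)
  essential_succ : ∀ n : ℕ, IsEssentialSubmodule Λ (LinearMap.range (d n))

/-- The `(l, n)`-condition on `Λ`: in the minimal injective resolution `0 → Λ → I⁰ → I¹ → ⋯` of the
left module `Λ`, the flat dimension of `Iⁱ` is less than `l` for all `0 ≤ i < n`. -/
def AuslanderCondition (l n : ℕ) : Prop :=
  ∃ R : MinimalInjectiveResolution Λ Λ, ∀ i < n, HasFlatDimLT Λ l (R.I i)

/-- The dominant dimension of `Λ`: the supremum of the `n` such that, in the minimal injective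
resolution `0 → Λ → I⁰ → I¹ → ⋯` of the left module `Λ`, the modules `I⁰, …, Iⁿ⁻¹` are flat. -/
noncomputable def dominantDimension : ℕ∞ :=
  sSup {k : ℕ∞ | ∃ n : ℕ, k = n ∧
    ∃ R : MinimalInjectiveResolution Λ Λ, ∀ i < n, IsFlatModule Λ (R.I i)}

end Resolution

/-!
Call a finitely generated left module `T` *torsion* if `T^* = 0`, and a submodule `N ≤ M` *dense*
if `M / N` is torsion. Everything passes through two conditions on finitely generated left modules:

* `EvalKernelHasZeroDual`: for every `M` the kernel of `M → M^**` is torsion;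
* `ExtendsFromDense`: functionals on a dense submodule of `M` extend to `M`, that is,
  `Ext¹(T, Λ) = 0` for torsion `T`.

**Abelian implies the conditions.** As `Λ` is reflexive, monomorphisms of `refl Λ` are injective, and
epimorphisms are the homomorphisms with dense range. Write `M = Λⁿ / I` and let `Λᵐ → Λⁿ` have range
`I`. Its image `J` in `refl Λ` is the kernel of a map to a reflexive module, so `Λⁿ / J` embeds into
its double dual, while `Λᵐ → J` is epi, so `J / I` is torsion; hence `J / I` is the kernel of
`M → M^**` (`ReflCat.evalKernelHasZeroDual`). If `M` itself is torsion, then `Λᵐ → Λⁿ` is epi, hence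
the cokernel of its kernel, so functionals on `I` extend to `Λⁿ` (`ReflCat.extendsFromDense`).

**The conditions against flatness.** An injective module `E` over a left Noetherian ring is flat
iff every map from a finitely generated module to `E` factors through some `Λⁿ`
(`IsFlatModule.factorsThroughFree`, `FactorsThroughFree.isFlatModule`). A generating family of `M^*`
gives a map `M → Λⁿ` whose kernel is that of `M → M^**`, so under the first condition `E` is flat as
soon as torsion modules have no nonzero maps to `E`. For `E = I⁰` and `E = I¹` this follows from the
second condition, because torsion modules are then closed under submodules and `I⁰`, `I¹` are
essential over `Λ` and `I⁰ / Λ` (`ExtendsFromDense.hom_zero_eq_zero`,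
`ExtendsFromDense.hom_one_eq_zero`). Conversely, if `I⁰` and `I¹` are flat then torsion modules have
no nonzero maps to them, and both conditions follow; flatness of `I⁰ ⊇ Λ` moreover gives that `(-)^**`
preserves injections (`bidualPreservesInjections_of_factorsThroughFree`).

**The conditions imply abelian.** Call `N ≤ M` closed if `M / N` embeds into its double dual. Since
`(-)^**` preserves injections, closed submodules of reflexive modules are reflexive, so kernels in
`refl Λ` are kernels of modules. Reflexive modules are closed in some `Λⁿ`, so that maps to them
extend uniquely from dense submodules (`ExtendsFromDense.exists_extension`,
`IsDenseSubmodule.eq_of_eqOn`). Thus `refl Λ` is the category of closed objects for the torsion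
theory, and cokernels and normality of monomorphisms and epimorphisms are read off from this
(`exists_reflexive_cokernel`, `dualClosure_range_le`, `ReflCat.nonempty_abelian`).

Minimal injective resolutions exist because injective hulls do (`exists_injective_hull`).
-/

/-! ### Extension and descent of linear maps -/

section Basics

variable {Λ : Type u} [Ring Λ]

theorem exists_comp_eq_of_ker_le {P S E : Type u} [AddCommGroup P] [Module Λ P] [AddCommGroup S]
    [Module Λ S] [AddCommGroup E] [Module Λ E] (a : P →ₗ[Λ] S) (ha : Function.Surjective a)
    (v : P →ₗ[Λ] E) (h : LinearMap.ker a ≤ LinearMap.ker v) :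
    ∃ w : S →ₗ[Λ] E, w ∘ₗ a = v := by
  refine ⟨(LinearMap.ker a).liftQ v h ∘ₗ (a.quotKerEquivOfSurjective ha).symm.toLinearMap, ?_⟩
  ext x
  have : (a.quotKerEquivOfSurjective ha).symm (a x) = Submodule.Quotient.mk x := by
    rw [LinearEquiv.symm_apply_eq]; rfl
  simp [this]

theorem exists_lift_of_range_le {N A E : Type u} [AddCommGroup N] [Module Λ N] [AddCommGroup A]
    [Module Λ A] [AddCommGroup E] [Module Λ E] (i : A →ₗ[Λ] E) (hi : Function.Injective i)
    (v : N →ₗ[Λ] E) (h : LinearMap.range v ≤ LinearMap.range i) :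
    ∃ w : N →ₗ[Λ] A, i ∘ₗ w = v := by
  refine ⟨(LinearEquiv.ofInjective i hi).symm.toLinearMap ∘ₗ
    v.codRestrict (LinearMap.range i) fun x => h ⟨x, rfl⟩, ?_⟩
  ext x
  have := (LinearEquiv.ofInjective i hi).apply_symm_apply ⟨v x, h ⟨x, rfl⟩⟩
  exact congrArg Subtype.val this

theorem Module.Injective.exists_extension {M P E : Type u} [AddCommGroup M] [Module Λ M]
    [AddCommGroup P] [Module Λ P] [AddCommGroup E] [Module Λ E] (hE : Module.Injective Λ E)
    (a : M →ₗ[Λ] P) (v : M →ₗ[Λ] E) (h : LinearMap.ker a ≤ LinearMap.ker v) :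
    ∃ w : P →ₗ[Λ] E, w ∘ₗ a = v := by
  obtain ⟨v', hv'⟩ := exists_comp_eq_of_ker_le a.rangeRestrict a.surjective_rangeRestrict v
    (by rwa [LinearMap.ker_rangeRestrict])
  obtain ⟨w, hw⟩ := hE.out (LinearMap.range a).subtype (Submodule.subtype_injective _) v'
  refine ⟨w, ?_⟩
  rw [← hv']
  ext x
  exact hw (a.rangeRestrict x)

/-! ### Duals over a Noetherian ring and reflexive modules -/

variable {M : Type u} [AddCommGroup M] [Module Λ M]

theorem mem_ker_evalDoubleDual {m : M} :
    m ∈ LinearMap.ker (evalDoubleDual Λ M) ↔ ∀ f : M →ₗ[Λ] Λ, f m = 0 := by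
  rw [LinearMap.mem_ker]
  exact ⟨fun h f => LinearMap.congr_fun h f, fun h => LinearMap.ext h⟩

theorem eq_zero_of_forall_dual_eq_zero (h : Function.Injective (evalDoubleDual Λ M)) {m : M}
    (hm : ∀ f : M →ₗ[Λ] Λ, f m = 0) : m = 0 := by
  apply h
  rw [map_zero]
  exact LinearMap.ext hm

/-- The dual `g^* : N^* → M^*` of `g : M → N`, as a homomorphism of right modules. -/
def dualMapOp {N : Type u} [AddCommGroup N] [Module Λ N] (g : M →ₗ[Λ] N) :
    RingDual Λ N →ₗ[Λᵐᵒᵖ] RingDual Λ M where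
  toFun f := f ∘ₗ g
  map_add' _ _ := rfl
  map_smul' _ _ := rfl

@[simp]
theorem dualMapOp_apply {N : Type u} [AddCommGroup N] [Module Λ N] (g : M →ₗ[Λ] N)
    (f : RingDual Λ N) : dualMapOp g f = f ∘ₗ g :=
  rfl

theorem isReflexiveModule_pi (n : ℕ) : IsReflexiveModule Λ (Fin n → Λ) := by
  refine ⟨inferInstance, ?_, ?_⟩
  · rw [← LinearMap.ker_eq_bot, eq_bot_iff]
    intro m hm
    rw [mem_ker_evalDoubleDual] at hm
    exact funext fun i => hm (LinearMap.proj i)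
  · intro φ
    refine ⟨fun i => φ (LinearMap.proj i), ?_⟩
    ext f
    -- every functional is the right linear combination of the coordinate functionals
    have hf : f = ∑ i, op (f (Pi.single i 1)) • (LinearMap.proj i : (Fin n → Λ) →ₗ[Λ] Λ) := by
      ext j
      simp [Pi.single_apply]
    conv_rhs => rw [hf, map_sum]
    change f _ = _
    conv_lhs => rw [hf]
    simp [LinearMap.sum_apply]

theorem isReflexiveModule_prod {N : Type u} [AddCommGroup N] [Module Λ N]
    (hM : IsReflexiveModule Λ M) (hN : IsReflexiveModule Λ N) : IsReflexiveModule Λ (M × N) := by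
  obtain ⟨hf, hi, hs⟩ := hM
  obtain ⟨hf', hi', hs'⟩ := hN
  refine ⟨inferInstance, ?_, ?_⟩
  · rw [← LinearMap.ker_eq_bot, eq_bot_iff]
    intro m hm
    rw [mem_ker_evalDoubleDual] at hm
    exact Prod.ext (eq_zero_of_forall_dual_eq_zero hi fun f => hm (f ∘ₗ LinearMap.fst Λ M N))
      (eq_zero_of_forall_dual_eq_zero hi' fun f => hm (f ∘ₗ LinearMap.snd Λ M N))
  · intro φ
    obtain ⟨m, hm⟩ := hs (φ ∘ₗ dualMapOp (LinearMap.fst Λ M N))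
    obtain ⟨n, hn⟩ := hs' (φ ∘ₗ dualMapOp (LinearMap.snd Λ M N))
    refine ⟨(m, n), ?_⟩
    ext f
    have h1 := LinearMap.congr_fun hm (f ∘ₗ LinearMap.inl Λ M N)
    have h2 := LinearMap.congr_fun hn (f ∘ₗ LinearMap.inr Λ M N)
    change f (m, 0) = φ _ at h1
    change f (0, n) = φ _ at h2
    change f (m, n) = φ f
    have h3 : f (m, n) = f (m, 0) + f (0, n) := by rw [← map_add]; simp
    rw [h3, h1, h2, ← map_add]
    congr 1
    have h0 : f ((0, 0) : M × N) = 0 := map_zero f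
    ext x <;> simp [h0]

variable (Λ M) in
theorem finite_ringDual [IsNoetherianRing Λᵐᵒᵖ] [Module.Finite Λ M] :
    Module.Finite Λᵐᵒᵖ (RingDual Λ M) := by
  obtain ⟨n, s, hs⟩ := Module.Finite.exists_fin (R := Λ) (M := M)
  let e : Λ ≃ₗ[Λᵐᵒᵖ] Λᵐᵒᵖ :=
    { opAddEquiv with map_smul' := fun a x => by simp }
  have : IsNoetherian Λᵐᵒᵖ Λ := isNoetherian_of_linearEquiv e.symm
  let r : RingDual Λ M →ₗ[Λᵐᵒᵖ] (Fin n → Λ) :=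
    { toFun := fun f i => f (s i)
      map_add' := fun _ _ => rfl
      map_smul' := fun _ _ => rfl }
  have hr : Function.Injective r := by
    intro f g h
    refine LinearMap.ext_on_range hs fun i => congrFun h i
  exact Module.Finite.of_injective r hr

variable (Λ M) in
/-- A finitely generated module has a left approximation by a free module of finite rank: its
components generate the dual. -/
theorem exists_free_approximation [IsNoetherianRing Λᵐᵒᵖ] [Module.Finite Λ M] :
    ∃ (n : ℕ) (a : M →ₗ[Λ] (Fin n → Λ)), ∀ f : M →ₗ[Λ] Λ,
      ∃ b : (Fin n → Λ) →ₗ[Λ] Λ, b ∘ₗ a = f := by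
  have := finite_ringDual Λ M
  obtain ⟨n, s, hs⟩ := Module.Finite.exists_fin (R := Λᵐᵒᵖ) (M := RingDual Λ M)
  refine ⟨n, LinearMap.pi s, fun f => ?_⟩
  have hf : f ∈ Submodule.span Λᵐᵒᵖ (Set.range s) := hs ▸ Submodule.mem_top
  obtain ⟨c, rfl⟩ := (Submodule.mem_span_range_iff_exists_fun _).1 hf
  refine ⟨∑ i, c i • (LinearMap.proj i : (Fin n → Λ) →ₗ[Λ] Λ), ?_⟩
  ext x
  simp [LinearMap.sum_apply]

theorem ker_free_approximation {n : ℕ} (a : M →ₗ[Λ] (Fin n → Λ))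
    (ha : ∀ f : M →ₗ[Λ] Λ, ∃ b : (Fin n → Λ) →ₗ[Λ] Λ, b ∘ₗ a = f) :
    LinearMap.ker a = LinearMap.ker (evalDoubleDual Λ M) := by
  ext x
  rw [mem_ker_evalDoubleDual, LinearMap.mem_ker]
  constructor
  · intro hx f
    obtain ⟨b, rfl⟩ := ha f
    simp [hx]
  · intro h
    exact funext fun i => h (LinearMap.proj i ∘ₗ a)

end Basics

/-! ### Dense submodules and the torsion conditions -/

section Conditions

/-- A submodule `N` of `M` is dense if `(M / N)^* = 0`, that is, if every functional on `M` that
vanishes on `N` is zero. -/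
def IsDenseSubmodule {Λ : Type u} [Ring Λ] {M : Type u} [AddCommGroup M] [Module Λ M]
    (N : Submodule Λ M) : Prop :=
  ∀ f : M →ₗ[Λ] Λ, N ≤ LinearMap.ker f → f = 0

variable (Λ : Type u) [Ring Λ]

/-- For every finitely generated `M`, the kernel of `M → M^**` has zero dual. -/
def EvalKernelHasZeroDual : Prop :=
  ∀ (M : Type u) [AddCommGroup M] [Module Λ M] [Module.Finite Λ M]
    (f : LinearMap.ker (evalDoubleDual Λ M) →ₗ[Λ] Λ), f = 0

/-- Functionals on dense submodules of finitely generated modules extend; equivalently,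
`Ext¹(T, Λ) = 0` for every finitely generated `T` with `T^* = 0`. -/
def ExtendsFromDense : Prop :=
  ∀ (M : Type u) [AddCommGroup M] [Module Λ M] [Module.Finite Λ M] (N : Submodule Λ M),
    IsDenseSubmodule N → ∀ g : N →ₗ[Λ] Λ, ∃ h : M →ₗ[Λ] Λ, h ∘ₗ N.subtype = g

/-- The double dual preserves injections of finitely generated modules: an element of `L^**`
that vanishes on the restrictions to `L` of the functionals on `M` is zero. -/
def BidualPreservesInjections : Prop :=
  ∀ (M : Type u) [AddCommGroup M] [Module Λ M] [Module.Finite Λ M] (L : Submodule Λ M)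
    (φ : RingDoubleDual Λ L), (∀ g : M →ₗ[Λ] Λ, φ (g ∘ₗ L.subtype) = 0) → φ = 0

/-- Every homomorphism from a finitely generated module to `E` factors through a free module of
finite rank. Over a left Noetherian ring this says that `E` is flat. -/
def FactorsThroughFree (E : Type u) [AddCommGroup E] [Module Λ E] : Prop :=
  ∀ (M : Type u) [AddCommGroup M] [Module Λ M] [Module.Finite Λ M] (v : M →ₗ[Λ] E),
    ∃ (n : ℕ) (a : M →ₗ[Λ] (Fin n → Λ)) (b : (Fin n → Λ) →ₗ[Λ] E), b ∘ₗ a = v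

variable {Λ}

/-! ### From the torsion conditions to the injective resolution -/

/-- Under the extension condition the modules with zero dual are closed under submodules. -/
theorem ExtendsFromDense.dual_submodule_eq_zero (h : ExtendsFromDense Λ) {T : Type u}
    [AddCommGroup T] [Module Λ T] [Module.Finite Λ T] (hT : ∀ f : T →ₗ[Λ] Λ, f = 0)
    (S : Submodule Λ T) (g : S →ₗ[Λ] Λ) : g = 0 := by
  obtain ⟨f, rfl⟩ := h T S (fun f _ => hT f) g
  rw [hT f, LinearMap.zero_comp]

theorem IsEssentialSubmodule.eq_zero_of_comap {T E : Type u} [AddCommGroup T] [Module Λ T]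
    [AddCommGroup E] [Module Λ E] {N : Submodule Λ E} (hN : IsEssentialSubmodule Λ N)
    (v : T →ₗ[Λ] E) (hv : ∀ t, v t ∈ N → v t = 0) : v = 0 := by
  rw [← LinearMap.range_eq_bot]
  apply hN
  rw [eq_bot_iff]
  rintro _ ⟨hx, t, rfl⟩
  exact hv t hx

theorem ExtendsFromDense.hom_zero_eq_zero (h : ExtendsFromDense Λ)
    (R : MinimalInjectiveResolution Λ Λ) {T : Type u} [AddCommGroup T] [Module Λ T]
    [Module.Finite Λ T] (hT : ∀ f : T →ₗ[Λ] Λ, f = 0) (v : T →ₗ[Λ] R.I 0) : v = 0 := by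
  refine R.essential_zero.eq_zero_of_comap v fun t ht => ?_
  set S := (LinearMap.range R.ι).comap v
  obtain ⟨w, hw⟩ := exists_lift_of_range_le R.ι R.ι_injective (v ∘ₗ S.subtype) (by
    rintro _ ⟨s, rfl⟩
    exact s.2)
  have := LinearMap.congr_fun hw ⟨t, ht⟩
  rw [h.dual_submodule_eq_zero hT S w] at this
  simpa using this.symm

theorem ExtendsFromDense.hom_one_eq_zero [IsNoetherianRing Λ] (h : ExtendsFromDense Λ)
    (R : MinimalInjectiveResolution Λ Λ) {T : Type u} [AddCommGroup T] [Module Λ T]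
    [Module.Finite Λ T] (hT : ∀ f : T →ₗ[Λ] Λ, f = 0) (v : T →ₗ[Λ] R.I 1) : v = 0 := by
  refine (R.essential_succ 0).eq_zero_of_comap v fun t ht => ?_
  set S := (LinearMap.range (R.d 0)).comap v
  have hS : ∀ f : S →ₗ[Λ] Λ, f = 0 := h.dual_submodule_eq_zero hT S
  obtain ⟨n, a, ha⟩ := Module.Finite.exists_fin' Λ S
  obtain ⟨x, hx⟩ := ha ⟨t, ht⟩
  -- lift `v` on a free cover of `S` along `d 0`
  obtain ⟨y, hy⟩ := Module.projective_lifting_property (R.d 0).rangeRestrict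
    ((v ∘ₗ S.subtype ∘ₗ a).codRestrict (LinearMap.range (R.d 0)) fun x => (a x).2)
    (R.d 0).surjective_rangeRestrict
  have hy' : ∀ x, R.d 0 (y x) = v (a x) := fun x => congrArg Subtype.val (LinearMap.congr_fun hy x)
  -- on the relations the lift takes values in `Λ`; extend these values to the cover
  obtain ⟨g, hg⟩ := exists_lift_of_range_le R.ι R.ι_injective
      (y ∘ₗ (LinearMap.ker a).subtype) (by
    rintro _ ⟨z, rfl⟩
    refine (R.exact_zero _).1 ?_
    simp [hy'])
  obtain ⟨w, rfl⟩ := h _ (LinearMap.ker a) (fun f hf => by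
    obtain ⟨f', rfl⟩ := exists_comp_eq_of_ker_le a ha f hf
    rw [hS f', LinearMap.zero_comp]) g
  -- the difference descends to `S`, hence vanishes
  obtain ⟨q, hq⟩ := exists_comp_eq_of_ker_le a ha (y - R.ι ∘ₗ w) (fun z hz => by
    have := LinearMap.congr_fun hg ⟨z, hz⟩
    simp only [LinearMap.comp_apply, Submodule.subtype_apply] at this
    simp [this])
  rw [h.hom_zero_eq_zero R hS q, LinearMap.zero_comp, eq_comm, sub_eq_zero] at hq
  have h1 := hy' x
  rw [hx, hq] at h1
  rw [← show R.d 0 (R.ι (w x)) = v t from h1]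
  exact (R.exact_zero _).2 ⟨_, rfl⟩

theorem EvalKernelHasZeroDual.factorsThroughFree [IsNoetherianRing Λ] [IsNoetherianRing Λᵐᵒᵖ]
    (h : EvalKernelHasZeroDual Λ) {E : Type u} [AddCommGroup E] [Module Λ E]
    (hE : Module.Injective Λ E)
    (h0 : ∀ (T : Type u) [AddCommGroup T] [Module Λ T] [Module.Finite Λ T],
      (∀ f : T →ₗ[Λ] Λ, f = 0) → ∀ v : T →ₗ[Λ] E, v = 0) : FactorsThroughFree Λ E := by
  intro M _ _ _ v
  obtain ⟨n, a, ha⟩ := exists_free_approximation Λ M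
  obtain ⟨b, hb⟩ := hE.exists_extension a v (by
    rw [ker_free_approximation a ha]
    intro x hx
    exact LinearMap.congr_fun (h0 _ (h M) (v ∘ₗ Submodule.subtype _)) ⟨x, hx⟩)
  exact ⟨n, a, b, hb⟩

/-! ### From the injective resolution to the torsion conditions -/

theorem FactorsThroughFree.hom_eq_zero {E : Type u} [AddCommGroup E] [Module Λ E]
    (h : FactorsThroughFree Λ E) {T : Type u} [AddCommGroup T] [Module Λ T] [Module.Finite Λ T]
    (hT : ∀ f : T →ₗ[Λ] Λ, f = 0) (v : T →ₗ[Λ] E) : v = 0 := by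
  obtain ⟨n, a, b, rfl⟩ := h T v
  have : a = 0 := by
    ext t i
    exact LinearMap.congr_fun (hT (LinearMap.proj i ∘ₗ a)) t
  rw [this, LinearMap.comp_zero]

theorem evalKernelHasZeroDual_of_factorsThroughFree (R : MinimalInjectiveResolution Λ Λ)
    (h0 : FactorsThroughFree Λ (R.I 0)) : EvalKernelHasZeroDual Λ := by
  intro M _ _ _ f
  obtain ⟨v, hv⟩ := (R.injective 0).exists_extension (Submodule.subtype _) (R.ι ∘ₗ f) (by simp)
  obtain ⟨n, a, b, rfl⟩ := h0 M v
  ext x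
  apply R.ι_injective
  have hx : a x = 0 := funext fun i =>
    mem_ker_evalDoubleDual.1 x.2 (LinearMap.proj i ∘ₗ a)
  have := LinearMap.congr_fun hv x
  simp only [LinearMap.comp_apply, Submodule.subtype_apply, hx, map_zero] at this
  simp [← this]

theorem extendsFromDense_of_factorsThroughFree (R : MinimalInjectiveResolution Λ Λ)
    (h1 : FactorsThroughFree Λ (R.I 1)) : ExtendsFromDense Λ := by
  intro M _ _ _ N hN g
  obtain ⟨v, hv⟩ := (R.injective 0).exists_extension N.subtype (R.ι ∘ₗ g) (by simp)
  obtain ⟨q, hq⟩ := exists_comp_eq_of_ker_le N.mkQ N.mkQ_surjective (R.d 0 ∘ₗ v) (by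
    rw [N.ker_mkQ]
    intro x hx
    have := LinearMap.congr_fun hv ⟨x, hx⟩
    simp only [LinearMap.comp_apply, Submodule.subtype_apply] at this
    rw [LinearMap.mem_ker, LinearMap.comp_apply, this]
    exact (R.exact_zero _).2 ⟨_, rfl⟩)
  have hq0 : q = 0 := h1.hom_eq_zero (fun f => by
    have := hN (f ∘ₗ N.mkQ) (fun x hx => by
      simp [(Submodule.Quotient.mk_eq_zero N).2 hx])
    ext x
    exact LinearMap.congr_fun this x) q
  obtain ⟨w, rfl⟩ := exists_lift_of_range_le R.ι R.ι_injective v (by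
    rintro _ ⟨x, rfl⟩
    refine (R.exact_zero _).1 ?_
    have := LinearMap.congr_fun hq x
    simpa [hq0] using this.symm)
  refine ⟨w, ?_⟩
  ext x
  exact R.ι_injective (LinearMap.congr_fun hv x)

/-- If `E` is injective and flat and contains `Λ`, then `L^* ⊗ E = Hom(L, E)` is a quotient of
`M^* ⊗ E = Hom(M, E)` for `L ≤ M`, so a functional on `L^*` vanishing on the image of `M^*`
is zero. The proof spells this out in terms of elements. -/
theorem bidualPreservesInjections_of_factorsThroughFree [IsNoetherianRing Λ]
    {E : Type u} [AddCommGroup E] [Module Λ E] (hE : Module.Injective Λ E)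
    (ι : Λ →ₗ[Λ] E) (hι : Function.Injective ι)
    (h0 : FactorsThroughFree Λ E) : BidualPreservesInjections Λ := by
  intro M _ _ _ L φ hφ
  ext f
  apply hι
  obtain ⟨v, hv⟩ := hE.exists_extension L.subtype (ι ∘ₗ f) (by simp)
  obtain ⟨n, a, b, rfl⟩ := h0 M v
  -- the functionals `f` and `aᵢ` on `L` satisfy a linear relation with coefficients in `E`
  let p : L →ₗ[Λ] (Λ × (Fin n → Λ)) := f.prod (a ∘ₗ L.subtype)
  let c : (Λ × (Fin n → Λ)) →ₗ[Λ] E := ι.coprod (-b)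
  have hcp : c ∘ₗ p = 0 := by
    ext x
    have := LinearMap.congr_fun hv x
    simp only [LinearMap.comp_apply, Submodule.subtype_apply] at this
    simp [c, p, this]
  -- by flatness it is a combination of relations with coefficients in `Λ`
  obtain ⟨q, hq⟩ := exists_comp_eq_of_ker_le (LinearMap.range p).mkQ
    (LinearMap.range p).mkQ_surjective c (by
      rw [Submodule.ker_mkQ]
      rintro _ ⟨x, rfl⟩
      exact LinearMap.congr_fun hcp x)
  obtain ⟨k, r, s, rfl⟩ := h0 _ q
  let t : Λ × (Fin n → Λ) →ₗ[Λ] (Fin k → Λ) := r ∘ₗ (LinearMap.range p).mkQ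
  have htp : t ∘ₗ p = 0 := by
    ext x i
    simp [t, (Submodule.Quotient.mk_eq_zero (LinearMap.range p)).2 ⟨x, rfl⟩]
  -- `φ` preserves the relations with coefficients in `Λ`
  have ht : t (φ f, 0) = 0 := by
    funext j
    have h1 : op (t (1, 0) j) • f +
        ∑ i, op (t (0, Pi.single i 1) j) • (LinearMap.proj i ∘ₗ a ∘ₗ L.subtype) = 0 := by
      ext x
      have h2 := congrFun (LinearMap.congr_fun htp x) j
      have h3 : p x = f x • ((1, 0) : Λ × (Fin n → Λ)) +
          ∑ i, a x i • ((0, Pi.single i 1) : Λ × (Fin n → Λ)) := by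
        refine Prod.ext ?_ ?_
        · simp [p, Prod.fst_sum]
        · ext i
          simp [p, Prod.snd_sum, Pi.single_apply]
      rw [LinearMap.comp_apply, h3] at h2
      simp only [map_add, map_sum, map_smul] at h2
      simpa using h2
    have h4 := congrArg φ h1
    have h5 : ∀ i, φ (LinearMap.proj i ∘ₗ a ∘ₗ L.subtype) = 0 := fun i =>
      hφ (LinearMap.proj i ∘ₗ a)
    simp only [map_add, map_sum, map_smul, h5, smul_zero, Finset.sum_const_zero, add_zero,
      map_zero] at h4
    have h6 : ((φ f, 0) : Λ × (Fin n → Λ)) = φ f • ((1, 0) : Λ × (Fin n → Λ)) := by simp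
    rw [h6, map_smul]
    exact h4
  have := LinearMap.congr_fun hq (φ f, 0)
  change s (t (φ f, 0)) = c (φ f, 0) at this
  rw [ht, map_zero] at this
  simpa [c] using this.symm

end Conditions

/-! ### Flatness and factorization through free modules -/

section FlatFactor

/-- The additive map underlying a homomorphism of modules, as a `ℤ`-linear map. -/
abbrev LinearMap.toInt {S : Type u} [Ring S] {X Y : Type u} [AddCommGroup X] [Module S X]
    [AddCommGroup Y] [Module S Y] (f : X →ₗ[S] Y) : X →ₗ[ℤ] Y :=
  f.toAddMonoidHom.toIntLinearMap

variable {Λ : Type u} [Ring Λ] {X Y : Type u} [AddCommGroup X] [Module Λᵐᵒᵖ X]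
  [AddCommGroup Y] [Module Λᵐᵒᵖ Y] {M N : Type u} [AddCommGroup M] [Module Λ M]
  [AddCommGroup N] [Module Λ N]

theorem sub_mem_balancedRelations (x : X) (a : Λ) (m : M) :
    (op a • x) ⊗ₜ[ℤ] m - x ⊗ₜ[ℤ] (a • m) ∈ balancedRelations Λ X M :=
  AddSubgroup.subset_closure ⟨x, a, m, rfl⟩

theorem rTensor_toInt_lTensor_toInt (f : X →ₗ[Λᵐᵒᵖ] Y) (g : M →ₗ[Λ] N) (t : X ⊗[ℤ] M) :
    f.toInt.rTensor N (g.toInt.lTensor X t) = g.toInt.lTensor Y (f.toInt.rTensor M t) := by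
  rw [← LinearMap.comp_apply, ← LinearMap.comp_apply, LinearMap.rTensor_comp_lTensor,
    LinearMap.lTensor_comp_rTensor]

omit [Module Λᵐᵒᵖ X] in
theorem lTensor_toInt_lTensor_toInt {P : Type u} [AddCommGroup P] [Module Λ P] (g : M →ₗ[Λ] N)
    (g' : N →ₗ[Λ] P) (t : X ⊗[ℤ] M) :
    g'.toInt.lTensor X (g.toInt.lTensor X t) = (g' ∘ₗ g).toInt.lTensor X t := by
  rw [← LinearMap.lTensor_comp_apply]
  rfl

theorem isFlatModule_iff : IsFlatModule Λ M ↔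
    ∀ (X Y : Type u) [AddCommGroup X] [Module Λᵐᵒᵖ X] [AddCommGroup Y] [Module Λᵐᵒᵖ Y]
      (f : X →ₗ[Λᵐᵒᵖ] Y), Function.Injective f → ∀ t : X ⊗[ℤ] M,
        f.toInt.rTensor M t ∈ balancedRelations Λ Y M → t ∈ balancedRelations Λ X M := by
  unfold IsFlatModule
  refine forall₂_congr fun X Y => forall₄_congr fun _ _ _ _ => forall₂_congr fun f _ => ?_
  rw [injective_iff_map_eq_zero]
  constructor
  · intro h t ht
    exact (QuotientAddGroup.eq_zero_iff t).1 (h (QuotientAddGroup.mk t)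
      ((QuotientAddGroup.eq_zero_iff _).2 ht))
  · intro h t
    obtain ⟨t, rfl⟩ := QuotientAddGroup.mk_surjective t
    intro ht
    exact (QuotientAddGroup.eq_zero_iff t).2 (h t ((QuotientAddGroup.eq_zero_iff _).1 ht))

theorem lTensor_mem_balancedRelations (g : M →ₗ[Λ] N) {t : X ⊗[ℤ] M}
    (ht : t ∈ balancedRelations Λ X M) : g.toInt.lTensor X t ∈ balancedRelations Λ X N := by
  refine AddSubgroup.closure_induction (p := fun t _ =>
    g.toInt.lTensor X t ∈ balancedRelations Λ X N) ?_ ?_ ?_ ?_ ht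
  · rintro _ ⟨x, a, m, rfl⟩
    simpa using sub_mem_balancedRelations x a (g m)
  · simp
  · intro s t _ _ hs ht
    rw [map_add]
    exact add_mem hs ht
  · intro s _ hs
    rw [map_neg]
    exact neg_mem hs

/-- The relations that define `Y ⊗_Λ M` are images of relations for any surjection `X → Y`. -/
theorem exists_rTensor_eq_of_mem_balancedRelations (q : X →ₗ[Λᵐᵒᵖ] Y)
    (hq : Function.Surjective q) {t : Y ⊗[ℤ] M} (ht : t ∈ balancedRelations Λ Y M) :
    ∃ s ∈ balancedRelations Λ X M, q.toInt.rTensor M s = t := by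
  refine AddSubgroup.closure_induction (p := fun t _ =>
    ∃ s ∈ balancedRelations Λ X M, q.toInt.rTensor M s = t) ?_ ?_ ?_ ?_ ht
  · rintro _ ⟨y, a, m, rfl⟩
    obtain ⟨x, rfl⟩ := hq y
    exact ⟨_, sub_mem_balancedRelations x a m, by simp⟩
  · exact ⟨0, zero_mem _, map_zero _⟩
  · rintro _ _ _ _ ⟨s, hs, rfl⟩ ⟨t, ht, rfl⟩
    exact ⟨s + t, add_mem hs ht, map_add _ _ _⟩
  · rintro _ _ ⟨s, hs, rfl⟩
    exact ⟨-s, neg_mem hs, map_neg _ _⟩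

/-- The map `Λⁿ ⊗_ℤ M → Mⁿ`, `v ⊗ m ↦ (vᵢ • m)`, which identifies `Λⁿ ⊗_Λ M` with `Mⁿ`. -/
def piTensorAction (Λ : Type u) [Ring Λ] (M : Type u) [AddCommGroup M] [Module Λ M] (n : ℕ) :
    (Fin n → Λ) ⊗[ℤ] M →+ (Fin n → M) :=
  TensorProduct.liftAddHom
    { toFun := fun v =>
        { toFun := fun m i => v i • m
          map_zero' := by ext; simp
          map_add' := fun _ _ => by ext; simp }
      map_zero' := by ext; simp
      map_add' := fun _ _ => by ext; simp [add_smul] }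
    (fun r v m => by ext i; exact (smul_assoc r (v i) m).trans (smul_comm r (v i) m))

@[simp]
theorem piTensorAction_tmul (n : ℕ) (v : Fin n → Λ) (m : M) :
    piTensorAction Λ M n (v ⊗ₜ m) = fun i => v i • m :=
  rfl

theorem piTensorAction_eq_zero {n : ℕ} {t : (Fin n → Λ) ⊗[ℤ] M}
    (ht : t ∈ balancedRelations Λ (Fin n → Λ) M) : piTensorAction Λ M n t = 0 := by
  refine AddSubgroup.closure_induction (p := fun t _ => piTensorAction Λ M n t = 0)
    ?_ ?_ ?_ ?_ ht
  · rintro _ ⟨x, a, m, rfl⟩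
    ext i
    simp [mul_smul]
  · simp
  · intro s t _ _ hs ht
    simp [hs, ht]
  · intro s _ hs
    simp [hs]

/-- The map `X ⊗_ℤ Λⁿ → Xⁿ`, `x ⊗ v ↦ (x vᵢ)`, which identifies `X ⊗_Λ Λⁿ` with `Xⁿ`. -/
def tensorPiAction (Λ : Type u) [Ring Λ] (X : Type u) [AddCommGroup X] [Module Λᵐᵒᵖ X] (n : ℕ) :
    X ⊗[ℤ] (Fin n → Λ) →+ (Fin n → X) :=
  TensorProduct.liftAddHom
    { toFun := fun x =>
        { toFun := fun v i => op (v i) • x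
          map_zero' := by ext; simp
          map_add' := fun _ _ => by ext; simp [add_smul] }
      map_zero' := by ext; simp
      map_add' := fun _ _ => by ext; simp }
    (fun r x v => by
      ext i
      exact (smul_comm (op (v i)) r x).trans (smul_assoc r (op (v i)) x).symm)

@[simp]
theorem tensorPiAction_tmul (n : ℕ) (x : X) (v : Fin n → Λ) :
    tensorPiAction Λ X n (x ⊗ₜ v) = fun i => op (v i) • x :=
  rfl

theorem tensorPiAction_eq_zero {n : ℕ} {t : X ⊗[ℤ] (Fin n → Λ)}
    (ht : t ∈ balancedRelations Λ X (Fin n → Λ)) : tensorPiAction Λ X n t = 0 := by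
  refine AddSubgroup.closure_induction (p := fun t _ => tensorPiAction Λ X n t = 0)
    ?_ ?_ ?_ ?_ ht
  · rintro _ ⟨x, a, m, rfl⟩
    ext i
    simp [mul_smul]
  · simp
  · intro s t _ _ hs ht
    simp [hs, ht]
  · intro s _ hs
    simp [hs]

theorem sub_sum_tensorPiAction_mem {n : ℕ} (t : X ⊗[ℤ] (Fin n → Λ)) :
    (∑ i, tensorPiAction Λ X n t i ⊗ₜ[ℤ] (Pi.single i 1 : Fin n → Λ)) - t ∈
      balancedRelations Λ X (Fin n → Λ) := by
  induction t with
  | zero => simp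
  | add s t hs ht =>
    have := add_mem hs ht
    simp only [map_add, Pi.add_apply, add_tmul, Finset.sum_add_distrib]
    rwa [sub_add_sub_comm] at this
  | tmul x v =>
    have hv : v = ∑ i, v i • (Pi.single i 1 : Fin n → Λ) := by
      ext j
      simp [Pi.single_apply]
    have hxv : x ⊗ₜ[ℤ] v = ∑ i, x ⊗ₜ[ℤ] (v i • (Pi.single i 1 : Fin n → Λ)) := by
      rw [← tmul_sum, ← hv]
    simp only [tensorPiAction_tmul]
    rw [hxv, ← Finset.sum_sub_distrib]
    exact sum_mem fun i _ => sub_mem_balancedRelations x (v i) _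

theorem isFlatModule_pi (n : ℕ) : IsFlatModule Λ (Fin n → Λ) := by
  rw [isFlatModule_iff]
  intro X Y _ _ _ _ f hf t ht
  have nat : ∀ t : X ⊗[ℤ] (Fin n → Λ), ∀ i,
      tensorPiAction Λ Y n (f.toInt.rTensor _ t) i = f (tensorPiAction Λ X n t i) := by
    intro t i
    induction t with
    | zero => simp
    | add s t hs ht => simp [hs, ht]
    | tmul x v => simp
  have h0 : tensorPiAction Λ X n t = 0 := by
    ext i
    apply hf
    rw [← nat, tensorPiAction_eq_zero ht]
    simp
  simpa [h0] using neg_mem (sub_sum_tensorPiAction_mem t)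

/-! Elements of tensor products, and relations between them, come from finitely generated
submodules. -/

omit [Module Λᵐᵒᵖ Y] in
theorem exists_fg_lTensor_eq (t : Y ⊗[ℤ] M) :
    ∃ P : Submodule Λ M, P.FG ∧ ∃ s : Y ⊗[ℤ] P, P.subtype.toInt.lTensor Y s = t := by
  obtain ⟨k, y, m, rfl⟩ := TensorProduct.exists_sum_tmul_eq t
  refine ⟨Submodule.span Λ (Set.range m), Submodule.fg_span (Set.finite_range m),
    ∑ j, y j ⊗ₜ ⟨m j, Submodule.subset_span ⟨j, rfl⟩⟩, ?_⟩
  simp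

theorem exists_fg_lTensor_eq_of_mem_balancedRelations {t : Y ⊗[ℤ] M}
    (ht : t ∈ balancedRelations Λ Y M) : ∃ P : Submodule Λ M, P.FG ∧
      ∃ s ∈ balancedRelations Λ Y P, P.subtype.toInt.lTensor Y s = t := by
  refine AddSubgroup.closure_induction (p := fun t _ => ∃ P : Submodule Λ M, P.FG ∧
      ∃ s ∈ balancedRelations Λ Y P, P.subtype.toInt.lTensor Y s = t) ?_ ?_ ?_ ?_ ht
  · rintro _ ⟨y, a, m, rfl⟩
    refine ⟨Submodule.span Λ {m}, Submodule.fg_span_singleton m, _, sub_mem_balancedRelations y a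
      ⟨m, Submodule.mem_span_singleton_self m⟩, ?_⟩
    simp
  · exact ⟨⊥, Submodule.fg_bot, 0, zero_mem _, map_zero _⟩
  · rintro _ _ _ _ ⟨P, hP, s, hs, rfl⟩ ⟨Q, hQ, t, ht, rfl⟩
    refine ⟨P ⊔ Q, hP.sup hQ, _, add_mem
      (lTensor_mem_balancedRelations (Submodule.inclusion le_sup_left) hs)
      (lTensor_mem_balancedRelations (Submodule.inclusion le_sup_right) ht), ?_⟩
    rw [map_add, ← LinearMap.lTensor_comp_apply, ← LinearMap.lTensor_comp_apply]
    rfl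
  · rintro _ _ ⟨P, hP, s, hs, rfl⟩
    exact ⟨P, hP, -s, neg_mem hs, map_neg _ _⟩

omit [Module Λᵐᵒᵖ Y] in
theorem exists_fg_lTensor_inclusion_eq_zero {P : Submodule Λ M} (hP : P.FG) (t : Y ⊗[ℤ] P)
    (ht : P.subtype.toInt.lTensor Y t = 0) : ∃ Q : Submodule Λ M, Q.FG ∧ ∃ h : P ≤ Q,
      (Submodule.inclusion h).toInt.lTensor Y t = 0 := by
  obtain ⟨k, y, m, rfl⟩ := TensorProduct.exists_sum_tmul_eq t
  let A : Submodule ℤ M := Submodule.span ℤ (Set.range fun j => (m j : M))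
  let s : A ⊗[ℤ] Y := ∑ j, ⟨m j, Submodule.subset_span ⟨j, rfl⟩⟩ ⊗ₜ y j
  obtain ⟨B, hAB, hB, hs⟩ := TensorProduct.eq_zero_of_fg_of_subtype_eq_zero
    (P := A) (Submodule.fg_span (Set.finite_range _)) (t := s) (by
      have := congrArg (TensorProduct.comm ℤ Y M) ht
      simpa [s] using this)
  obtain ⟨S, hS⟩ := hB
  let Q : Submodule Λ M := P ⊔ Submodule.span Λ (S : Set M)
  have hBQ : ∀ b ∈ B, b ∈ Q := by
    intro b hb
    rw [← hS] at hb
    refine Submodule.span_induction (p := fun b _ => b ∈ Q) ?_ (zero_mem _)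
      (fun _ _ _ _ => add_mem) (fun n _ _ hx => zsmul_mem hx n) hb
    exact fun x hx => Submodule.mem_sup_right (Submodule.subset_span hx)
  refine ⟨Q, hP.sup (Submodule.fg_span S.finite_toSet), le_sup_left, ?_⟩
  let i : B →ₗ[ℤ] Q :=
    { toFun := fun b => ⟨b, hBQ b b.2⟩
      map_add' := fun _ _ => rfl
      map_smul' := fun _ _ => rfl }
  have := congrArg (TensorProduct.comm ℤ Q Y) (congrArg (i.rTensor Y) hs)
  simp only [s, i, map_sum, LinearMap.rTensor_tmul, map_zero, comm_tmul] at this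
  simp only [map_sum, LinearMap.lTensor_tmul]
  exact this

/-- If every map from a finitely generated module to `E` factors through a free module of finite
rank, then `E` is flat: an element of `X ⊗ E` that dies in `Y ⊗ E` comes from an element of `X ⊗ Q`
that dies in `Y ⊗ Q`, for a finitely generated `Q ≤ E`, and `Q → E` factors through a module that
is flat. -/
theorem FactorsThroughFree.isFlatModule {E : Type u} [AddCommGroup E] [Module Λ E]
    (h : FactorsThroughFree Λ E) : IsFlatModule Λ E := by
  rw [isFlatModule_iff]
  intro X Y _ _ _ _ f hf t ht
  obtain ⟨P₁, hP₁, t₁, rfl⟩ := exists_fg_lTensor_eq (Λ := Λ) t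
  obtain ⟨P₂, hP₂, s₂, hs₂, hst⟩ := exists_fg_lTensor_eq_of_mem_balancedRelations ht
  obtain ⟨Q, hQ, hle, hz⟩ := exists_fg_lTensor_inclusion_eq_zero (hP₁.sup hP₂)
    ((Submodule.inclusion le_sup_right).toInt.lTensor Y s₂ -
      (Submodule.inclusion le_sup_left).toInt.lTensor Y (f.toInt.rTensor _ t₁)) (by
      rw [map_sub, sub_eq_zero, lTensor_toInt_lTensor_toInt, lTensor_toInt_lTensor_toInt]
      exact hst.trans (rTensor_toInt_lTensor_toInt _ _ _))
  have := Module.Finite.iff_fg.2 hQ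
  let t₂ : X ⊗[ℤ] Q := (Submodule.inclusion (le_sup_left.trans hle)).toInt.lTensor X t₁
  have ht₂ : f.toInt.rTensor Q t₂ ∈ balancedRelations Λ Y Q := by
    rw [map_sub, sub_eq_zero, lTensor_toInt_lTensor_toInt, lTensor_toInt_lTensor_toInt] at hz
    rw [rTensor_toInt_lTensor_toInt]
    have := lTensor_mem_balancedRelations (Submodule.inclusion (le_sup_right.trans hle)) hs₂
    have hz' : (Submodule.inclusion (le_sup_right.trans hle)).toInt.lTensor Y s₂ =
      (Submodule.inclusion (le_sup_left.trans hle)).toInt.lTensor Y (f.toInt.rTensor _ t₁) := hz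
    rwa [hz'] at this
  obtain ⟨n, a, b, hab⟩ := h Q Q.subtype
  have hat : a.toInt.lTensor X t₂ ∈ balancedRelations Λ X (Fin n → Λ) := by
    refine isFlatModule_iff.1 (isFlatModule_pi n) X Y f hf _ ?_
    rw [rTensor_toInt_lTensor_toInt]
    exact lTensor_mem_balancedRelations a ht₂
  have := lTensor_mem_balancedRelations b hat
  rwa [lTensor_toInt_lTensor_toInt, hab, lTensor_toInt_lTensor_toInt] at this

/-- The equational criterion for flatness: relations with coefficients in a flat module `E` are
combinations of relations with coefficients in `Λ`, so a homomorphism from a finitely presented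
module to `E` factors through a free module. -/
theorem IsFlatModule.factorsThroughFree [IsNoetherianRing Λ] {E : Type u} [AddCommGroup E]
    [Module Λ E] (h : IsFlatModule Λ E) : FactorsThroughFree Λ E := by
  intro M _ _ _ v
  obtain ⟨n, p, hp⟩ := Module.Finite.exists_fin' Λ M
  obtain ⟨m, r, hr⟩ := Submodule.fg_iff_exists_fin_generating_family.1
    (IsNoetherian.noetherian (LinearMap.ker p))
  let e : Fin n → E := fun j => v (p (Pi.single j 1))
  -- left multiplication by the matrix of relations, as a homomorphism of right modules
  let A : (Fin n → Λ) →ₗ[Λᵐᵒᵖ] (Fin m → Λ) :=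
    { toFun := fun x i => ∑ j, r i j * x j
      map_add' := fun x y => by ext; simp [mul_add, Finset.sum_add_distrib]
      map_smul' := fun a x => by ext; simp [Finset.sum_mul, mul_assoc] }
  let K := LinearMap.ker A
  let f : ((Fin n → Λ) ⧸ K) →ₗ[Λᵐᵒᵖ] (Fin m → Λ) := K.liftQ A le_rfl
  have hf : Function.Injective f := LinearMap.ker_eq_bot.1 (Submodule.ker_liftQ_eq_bot' _ _ rfl)
  let t : (Fin n → Λ) ⊗[ℤ] E := ∑ j, (Pi.single j 1 : Fin n → Λ) ⊗ₜ e j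
  have ht : f.toInt.rTensor E (K.mkQ.toInt.rTensor E t) ∈
      balancedRelations Λ (Fin m → Λ) E := by
    have hA : ∀ j, A (Pi.single j 1) = ∑ i, op (r i j) • (Pi.single i 1 : Fin m → Λ) := by
      intro j
      ext i
      simp [A, Pi.single_apply]
    have hr0 : ∀ i, ∑ j, r i j • e j = 0 := by
      intro i
      have h1 : r i = ∑ j, r i j • (Pi.single j 1 : Fin n → Λ) := by
        ext j
        simp [Pi.single_apply]
      have h2 : v (p (r i)) = 0 := by
        rw [LinearMap.mem_ker.1 (hr ▸ Submodule.subset_span ⟨i, rfl⟩ : r i ∈ LinearMap.ker p),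
          map_zero]
      rw [h1] at h2
      simpa only [map_sum, map_smul] using h2
    have h1 : f.toInt.rTensor E (K.mkQ.toInt.rTensor E t) =
        ∑ j, ∑ i, (op (r i j) • (Pi.single i 1 : Fin m → Λ)) ⊗ₜ[ℤ] e j := by
      simp only [t, map_sum, LinearMap.rTensor_tmul]
      refine Finset.sum_congr rfl fun j _ => ?_
      rw [← sum_tmul, ← hA]
      rfl
    have h2 : ∑ j, ∑ i, (Pi.single i 1 : Fin m → Λ) ⊗ₜ[ℤ] (r i j • e j) = 0 := by
      rw [Finset.sum_comm]
      simp only [← tmul_sum, hr0, tmul_zero, Finset.sum_const_zero]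
    rw [← sub_zero (LinearMap.rTensor E _ _), h1, ← h2, ← Finset.sum_sub_distrib]
    refine sum_mem fun j _ => ?_
    rw [← Finset.sum_sub_distrib]
    exact sum_mem fun i _ => sub_mem_balancedRelations _ _ _
  obtain ⟨s, hs, hst⟩ := exists_rTensor_eq_of_mem_balancedRelations K.mkQ K.mkQ_surjective
    (isFlatModule_iff.1 h _ _ f hf _ ht)
  obtain ⟨w, hw⟩ := (rTensor_exact E (f := K.subtype.toInt) (g := K.mkQ.toInt)
    (LinearMap.exact_subtype_mkQ K) K.mkQ_surjective (t - s)).1 (by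
      rw [map_sub, hst, sub_self])
  obtain ⟨k, b, e', rfl⟩ := TensorProduct.exists_sum_tmul_eq w
  have he : ∀ j, ∑ l, (b l : Fin n → Λ) j • e' l = e j := by
    intro j
    have := congrArg (fun t => piTensorAction Λ E n t j) hw
    simpa [piTensorAction_eq_zero hs, t, Pi.single_apply] using this
  obtain ⟨a, ha⟩ := exists_comp_eq_of_ker_le p hp
    (LinearMap.pi fun l => ∑ j, (LinearMap.toSpanSingleton Λ Λ ((b l : Fin n → Λ) j)) ∘ₗ
      LinearMap.proj j : (Fin n → Λ) →ₗ[Λ] (Fin k → Λ)) (by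
      rw [← hr, Submodule.span_le]
      rintro _ ⟨i, rfl⟩
      ext l
      have : ∑ j, r i j * (b l : Fin n → Λ) j = 0 := congrFun (LinearMap.mem_ker.1 (b l).2) i
      simpa using this)
  refine ⟨k, a, ∑ l, (LinearMap.toSpanSingleton Λ E (e' l)) ∘ₗ LinearMap.proj l, ?_⟩
  rw [← LinearMap.cancel_right hp, LinearMap.comp_assoc, ha]
  ext j
  simpa [Pi.single_apply] using he j

end FlatFactor

/-! ### Injective hulls and minimal injective resolutions -/

section Hull

variable {Λ : Type u} [Ring Λ]

theorem Module.Injective.of_retract {E N : Type u} [AddCommGroup E] [Module Λ E]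
    [AddCommGroup N] [Module Λ N] (hE : Module.Injective Λ E) (i : N →ₗ[Λ] E) (r : E →ₗ[Λ] N)
    (h : r ∘ₗ i = LinearMap.id) : Module.Injective Λ N where
  out X Y _ _ _ _ f hf g := by
    obtain ⟨w, hw⟩ := hE.out f hf (i ∘ₗ g)
    refine ⟨r ∘ₗ w, fun x => ?_⟩
    rw [LinearMap.comp_apply, hw]
    exact LinearMap.congr_fun h (g x)

theorem Submodule.exists_maximal_disjoint {E : Type u} [AddCommGroup E] [Module Λ E]
    (N : Submodule Λ E) :
    ∃ C : Submodule Λ E, Disjoint N C ∧ ∀ D, Disjoint N D → C ≤ D → D = C := by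
  obtain ⟨C, -, hC⟩ := zorn_le_nonempty₀ {C : Submodule Λ E | Disjoint N C} (by
    intro c hc hchain y hy
    refine ⟨sSup c, ?_, fun z hz => le_sSup hz⟩
    exact (DirectedOn.disjoint_sSup_right hchain.directedOn).2 hc) ⊥ disjoint_bot_right
  exact ⟨C, hC.prop, fun D hD hCD => (hC.eq_of_le hD hCD).symm⟩

/-- Every module has an injective hull. It is a maximal essential extension of `M` inside an
injective module `E`; a maximal complement of such an extension is a genuine complement, so the
extension is a direct summand of `E`. -/
theorem exists_injective_hull (M : Type u) [AddCommGroup M] [Module Λ M] :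
    ∃ (E : ModuleCat.{u} Λ) (i : M →ₗ[Λ] E), Module.Injective Λ E ∧ Function.Injective i ∧
      IsEssentialSubmodule Λ (LinearMap.range i) := by
  obtain ⟨E, hE, i, hi⟩ : ∃ E : ModuleCat.{u} Λ, Module.Injective Λ E ∧
      ∃ i : M →ₗ[Λ] E, Function.Injective i := by
    refine ⟨Injective.under (ModuleCat.of Λ M), ?_, (Injective.ι (ModuleCat.of Λ M)).hom, ?_⟩
    · exact (Module.injective_iff_injective_object _ _).2 (Injective.injective_under _)
    · exact (ModuleCat.mono_iff_injective _).1 inferInstance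
  let S : Set (Submodule Λ E) :=
    {N | LinearMap.range i ≤ N ∧ ∀ L ≤ N, LinearMap.range i ⊓ L = ⊥ → L = ⊥}
  obtain ⟨N, -, hN⟩ := zorn_le_nonempty₀ S (by
    intro c hc hchain y hy
    refine ⟨sSup c, ⟨(hc hy).1.trans (le_sSup hy), fun L hL hL0 => ?_⟩, fun z hz => le_sSup hz⟩
    rw [Submodule.eq_bot_iff]
    intro x hx
    obtain ⟨P, hP, hxP⟩ := (Submodule.mem_sSup_of_directed ⟨y, hy⟩ hchain.directedOn).1 (hL hx)
    rw [← Submodule.span_singleton_eq_bot (R := Λ)]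
    refine (hc hP).2 _ ((Submodule.span_singleton_le_iff_mem _ _).2 hxP) ?_
    rw [eq_bot_iff, ← hL0]
    exact inf_le_inf_left _ ((Submodule.span_singleton_le_iff_mem _ _).2 hx))
    (LinearMap.range i) ⟨le_rfl, fun L hL h => by rwa [inf_eq_right.2 hL] at h⟩
  obtain ⟨⟨hiN, hess⟩, hmax⟩ := hN
  obtain ⟨C, hNC, hC⟩ := N.exists_maximal_disjoint
  -- extend the inclusion of `N` along the injection `N → E / C`
  obtain ⟨g, hg⟩ := hE.exists_extension (C.mkQ ∘ₗ N.subtype) N.subtype (by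
    intro x hx
    have h1 : (x : E) ∈ C := by simpa using hx
    have h2 : (x : E) = 0 := by
      have : (x : E) ∈ N ⊓ C := ⟨x.2, h1⟩
      rwa [hNC.eq_bot] at this
    simpa using h2)
  have hgN : ∀ x ∈ N, g (C.mkQ x) = x := fun x hx => LinearMap.congr_fun hg ⟨x, hx⟩
  have hle : N ≤ LinearMap.range g := fun x hx => ⟨_, hgN x hx⟩
  have hmem : LinearMap.range g ∈ S := by
    refine ⟨hiN.trans hle, fun L hL hL0 => ?_⟩
    have h1 : L ⊓ N = ⊥ := hess _ inf_le_right (by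
      rw [eq_bot_iff, ← hL0]
      exact inf_le_inf_left _ inf_le_left)
    have h2 : L.comap (g ∘ₗ C.mkQ) = C := by
      refine hC _ ?_ ?_
      · rw [disjoint_iff, Submodule.eq_bot_iff]
        rintro x ⟨hxN, hxL⟩
        have h3 : g (C.mkQ x) ∈ L := hxL
        rw [hgN x hxN] at h3
        have : x ∈ L ⊓ N := ⟨h3, hxN⟩
        rwa [h1] at this
      · intro x hx
        have : C.mkQ x = 0 := (Submodule.Quotient.mk_eq_zero C).2 hx
        simp only [Submodule.mem_comap, LinearMap.comp_apply, this, map_zero, zero_mem]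
    rw [Submodule.eq_bot_iff]
    intro x hx
    obtain ⟨y, rfl⟩ := hL hx
    obtain ⟨z, rfl⟩ := C.mkQ_surjective y
    have : z ∈ L.comap (g ∘ₗ C.mkQ) := hx
    rw [h2] at this
    have hz : C.mkQ z = 0 := (Submodule.Quotient.mk_eq_zero C).2 this
    rw [hz, map_zero]
  have hrange : ∀ x, g (C.mkQ x) ∈ N := fun x => hmax hmem hle ⟨_, rfl⟩
  refine ⟨ModuleCat.of Λ N, i.codRestrict N fun x => hiN ⟨x, rfl⟩,
    hE.of_retract N.subtype ((g ∘ₗ C.mkQ).codRestrict N hrange) ?_, ?_, ?_⟩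
  · ext x
    exact hgN x x.2
  · intro x y h
    exact hi (congrArg Subtype.val h)
  · intro L hL
    have := hess (L.map N.subtype) (N.map_subtype_le L) (by
      rw [Submodule.eq_bot_iff]
      rintro _ ⟨⟨m, rfl⟩, ⟨x, hx, hxm⟩⟩
      have : x ∈ LinearMap.range (i.codRestrict N fun x => hiN ⟨x, rfl⟩) ⊓ L :=
        ⟨⟨m, Subtype.ext hxm.symm⟩, hx⟩
      rw [hL] at this
      rw [← hxm, (Submodule.mem_bot Λ).1 this, map_zero])
    exact Submodule.map_injective_of_injective (Submodule.subtype_injective N)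
      (this.trans (Submodule.map_bot _).symm)

variable (Λ) in
/-- A chosen injective hull of a module. -/
noncomputable def injectiveHull (M : Type u) [AddCommGroup M] [Module Λ M] : ModuleCat.{u} Λ :=
  (exists_injective_hull (Λ := Λ) M).choose

variable (Λ) in
/-- The inclusion of a module into its injective hull. -/
noncomputable def injectiveHullInclusion (M : Type u) [AddCommGroup M] [Module Λ M] :
    M →ₗ[Λ] injectiveHull Λ M :=
  (exists_injective_hull (Λ := Λ) M).choose_spec.choose

theorem injectiveHull_spec (M : Type u) [AddCommGroup M] [Module Λ M] :
    Module.Injective Λ (injectiveHull Λ M) ∧ Function.Injective (injectiveHullInclusion Λ M) ∧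
      IsEssentialSubmodule Λ (LinearMap.range (injectiveHullInclusion Λ M)) :=
  (exists_injective_hull (Λ := Λ) M).choose_spec.choose_spec

variable (Λ) in
/-- One step of a coresolution: a homomorphism of modules. -/
structure CoresolutionStep where
  /-- The source of the homomorphism. -/
  source : ModuleCat.{u} Λ
  /-- The target of the homomorphism. -/
  target : ModuleCat.{u} Λ
  /-- The homomorphism. -/
  map : source →ₗ[Λ] target

/-- The step after `A → B` is `B → B / im A → E`, where `E` is the injective hull of the
cokernel. -/
noncomputable def CoresolutionStep.next (s : CoresolutionStep Λ) : CoresolutionStep Λ where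
  source := s.target
  target := injectiveHull Λ (s.target ⧸ LinearMap.range s.map)
  map := injectiveHullInclusion Λ _ ∘ₗ (LinearMap.range s.map).mkQ

theorem CoresolutionStep.exact_next (s : CoresolutionStep Λ) :
    Function.Exact s.map s.next.map := by
  intro y
  change injectiveHullInclusion Λ _ ((LinearMap.range s.map).mkQ y) = 0 ↔ _
  rw [map_eq_zero_iff _ (injectiveHull_spec _).2.1]
  exact Submodule.Quotient.mk_eq_zero _

theorem CoresolutionStep.essential_next (s : CoresolutionStep Λ) :
    IsEssentialSubmodule Λ (LinearMap.range s.next.map) := by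
  have : LinearMap.range s.next.map = LinearMap.range (injectiveHullInclusion Λ
      (s.target ⧸ LinearMap.range s.map)) :=
    LinearMap.range_comp_of_range_eq_top _ (Submodule.range_mkQ _)
  rw [this]
  exact (injectiveHull_spec _).2.2

variable (Λ) in
/-- The steps of the minimal injective resolution built from injective hulls. -/
noncomputable def coresolutionStep (M : Type u) [AddCommGroup M] [Module Λ M] :
    ℕ → CoresolutionStep Λ
  | 0 => ⟨ModuleCat.of Λ M, injectiveHull Λ M, injectiveHullInclusion Λ M⟩
  | n + 1 => (coresolutionStep M n).next

variable (Λ) in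
theorem nonempty_minimalInjectiveResolution (M : Type u) [AddCommGroup M] [Module Λ M] :
    Nonempty (MinimalInjectiveResolution Λ M) :=
  ⟨{  I := fun n => (coresolutionStep Λ M n).target
      ι := injectiveHullInclusion Λ M
      d := fun n => (coresolutionStep Λ M n).next.map
      injective := fun n => by
        cases n <;> exact (injectiveHull_spec _).1
      ι_injective := (injectiveHull_spec _).2.1
      exact_zero := (coresolutionStep Λ M 0).exact_next
      exact_succ := fun n => (coresolutionStep Λ M n).next.exact_next
      essential_zero := (injectiveHull_spec _).2.2
      essential_succ := fun n => (coresolutionStep Λ M n).essential_next }⟩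

end Hull

/-! ### Closed submodules and reflexive modules -/

section Closed

variable {Λ : Type u} [Ring Λ] {M : Type u} [AddCommGroup M] [Module Λ M]

/-- The closure of a submodule `N` of `M`: the common kernel of the functionals on `M` that vanish
on `N`. It is `N` itself exactly if `M / N` embeds into its double dual. -/
def Submodule.dualClosure (N : Submodule Λ M) : Submodule Λ M :=
  (LinearMap.ker (evalDoubleDual Λ (M ⧸ N))).comap N.mkQ

theorem Submodule.mem_dualClosure {N : Submodule Λ M} {m : M} :
    m ∈ N.dualClosure ↔ ∀ g : M →ₗ[Λ] Λ, N ≤ LinearMap.ker g → g m = 0 := by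
  rw [Submodule.dualClosure, Submodule.mem_comap, mem_ker_evalDoubleDual]
  constructor
  · intro h g hg
    exact h (N.liftQ g hg)
  · intro h f
    exact h (f ∘ₗ N.mkQ) fun x hx => by simp [(Submodule.Quotient.mk_eq_zero N).2 hx]

theorem Submodule.le_dualClosure (N : Submodule Λ M) : N ≤ N.dualClosure :=
  fun _ hx => Submodule.mem_dualClosure.2 fun _ hg => hg hx

theorem Submodule.dualClosure_idem (N : Submodule Λ M) :
    N.dualClosure.dualClosure ≤ N.dualClosure := fun _ hx =>
  Submodule.mem_dualClosure.2 fun g hg => Submodule.mem_dualClosure.1 hx g fun _ hy =>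
    Submodule.mem_dualClosure.1 hy g hg

theorem EvalKernelHasZeroDual.isDenseSubmodule_dualClosure (h : EvalKernelHasZeroDual Λ)
    [Module.Finite Λ M] (N : Submodule Λ M) :
    IsDenseSubmodule (N.comap N.dualClosure.subtype) := by
  intro f hf
  let q : N.dualClosure →ₗ[Λ] LinearMap.ker (evalDoubleDual Λ (M ⧸ N)) :=
    (N.mkQ ∘ₗ N.dualClosure.subtype).codRestrict _ fun x => x.2
  have hq : Function.Surjective q := by
    rintro ⟨y, hy⟩
    obtain ⟨x, rfl⟩ := N.mkQ_surjective y
    exact ⟨⟨x, hy⟩, rfl⟩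
  obtain ⟨f', rfl⟩ := exists_comp_eq_of_ker_le q hq f (by
    refine le_trans (fun x hx => ?_) hf
    exact (Submodule.Quotient.mk_eq_zero N).1 (congrArg Subtype.val (LinearMap.mem_ker.1 hx)))
  rw [h (M ⧸ N) f', LinearMap.zero_comp]

/-- Closed submodules of reflexive modules are reflexive. -/
theorem BidualPreservesInjections.isReflexiveModule_of_dualClosure_le [IsNoetherianRing Λ]
    (h : BidualPreservesInjections Λ) (hM : IsReflexiveModule Λ M) (L : Submodule Λ M)
    (hL : L.dualClosure ≤ L) : IsReflexiveModule Λ L := by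
  obtain ⟨hfin, hi, hs⟩ := hM
  refine ⟨inferInstance, ?_, ?_⟩
  · rw [← LinearMap.ker_eq_bot, eq_bot_iff]
    intro x hx
    rw [mem_ker_evalDoubleDual] at hx
    exact Subtype.ext (eq_zero_of_forall_dual_eq_zero hi fun g => hx (g ∘ₗ L.subtype))
  · intro φ
    obtain ⟨m, hm⟩ := hs (φ ∘ₗ dualMapOp L.subtype)
    have hm' : ∀ g : M →ₗ[Λ] Λ, g m = φ (g ∘ₗ L.subtype) := LinearMap.congr_fun hm
    have hmL : m ∈ L := hL (Submodule.mem_dualClosure.2 fun g hg => by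
      have : g ∘ₗ L.subtype = 0 := LinearMap.ext fun x => hg x.2
      rw [hm', this, map_zero])
    refine ⟨⟨m, hmL⟩, (sub_eq_zero.1 (h M L _ fun g => ?_)).symm⟩
    rw [LinearMap.sub_apply, sub_eq_zero, ← hm']
    rfl

/-- A reflexive module is a closed submodule of a free module of finite rank. -/
theorem IsReflexiveModule.exists_closed_embedding [IsNoetherianRing Λᵐᵒᵖ]
    (hM : IsReflexiveModule Λ M) : ∃ (n : ℕ) (i : M →ₗ[Λ] (Fin n → Λ)), Function.Injective i ∧
      (LinearMap.range i).dualClosure ≤ LinearMap.range i := by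
  obtain ⟨hfin, hi, hs⟩ := hM
  obtain ⟨n, a, ha⟩ := exists_free_approximation Λ M
  refine ⟨n, a, ?_, ?_⟩
  · rw [← LinearMap.ker_eq_bot, ker_free_approximation a ha, LinearMap.ker_eq_bot]
    exact hi
  · intro v hv
    rw [Submodule.mem_dualClosure] at hv
    -- evaluation at `v` descends along the surjection `(Λⁿ)^* → M^*`
    obtain ⟨φ, hφ⟩ := exists_comp_eq_of_ker_le (dualMapOp a) ha
      (evalDoubleDual Λ (Fin n → Λ) v) (fun b hb => hv b (by
        rintro _ ⟨x, rfl⟩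
        exact LinearMap.congr_fun (LinearMap.mem_ker.1 hb) x))
    obtain ⟨z, rfl⟩ := hs φ
    exact ⟨z, funext fun i => LinearMap.congr_fun hφ (LinearMap.proj i)⟩

/-- Homomorphisms to a reflexive module extend from dense submodules: first into a free module that
contains it as a closed submodule, and the extension does not leave the closure. -/
theorem ExtendsFromDense.exists_extension [IsNoetherianRing Λᵐᵒᵖ] (h : ExtendsFromDense Λ)
    [Module.Finite Λ M] {N : Submodule Λ M} (hN : IsDenseSubmodule N) {Z : Type u}
    [AddCommGroup Z] [Module Λ Z] (hZ : IsReflexiveModule Λ Z) (g : N →ₗ[Λ] Z) :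
    ∃ f : M →ₗ[Λ] Z, f ∘ₗ N.subtype = g := by
  obtain ⟨n, i, hi, hcl⟩ := hZ.exists_closed_embedding
  choose w hw using fun j => h M N hN (LinearMap.proj j ∘ₗ i ∘ₗ g)
  have hwg : ∀ x : N, LinearMap.pi w (x : M) = i (g x) := fun x =>
    funext fun j => LinearMap.congr_fun (hw j) x
  obtain ⟨f, hf⟩ := exists_lift_of_range_le i hi (LinearMap.pi w) (by
    rintro _ ⟨m, rfl⟩
    refine hcl (Submodule.mem_dualClosure.2 fun c hc => ?_)
    have := hN (c ∘ₗ LinearMap.pi w) fun x hx => by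
      rw [LinearMap.mem_ker, LinearMap.comp_apply, hwg ⟨x, hx⟩]
      exact hc ⟨_, rfl⟩
    exact LinearMap.congr_fun this m)
  refine ⟨f, ?_⟩
  ext x
  apply hi
  rw [← hwg x, ← hf]
  rfl

theorem IsDenseSubmodule.eq_of_eqOn {N : Submodule Λ M} (hN : IsDenseSubmodule N) {Z : Type u}
    [AddCommGroup Z] [Module Λ Z] (hZ : IsReflexiveModule Λ Z) {f g : M →ₗ[Λ] Z}
    (h : ∀ x ∈ N, f x = g x) : f = g := by
  ext m
  rw [← sub_eq_zero]
  refine eq_zero_of_forall_dual_eq_zero hZ.2.1 fun c => ?_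
  have := hN (c ∘ₗ (f - g)) fun x hx => by simp [h x hx]
  exact LinearMap.congr_fun this m

/-- The kernel of a homomorphism of reflexive modules is reflexive. -/
theorem BidualPreservesInjections.isReflexiveModule_ker [IsNoetherianRing Λ]
    (h : BidualPreservesInjections Λ) {Z : Type u} [AddCommGroup Z] [Module Λ Z]
    (hM : IsReflexiveModule Λ M) (hZ : IsReflexiveModule Λ Z) (f : M →ₗ[Λ] Z) :
    IsReflexiveModule Λ (LinearMap.ker f) :=
  h.isReflexiveModule_of_dualClosure_le hM _ fun _ hm =>
    eq_zero_of_forall_dual_eq_zero hZ.2.1 fun c =>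
      Submodule.mem_dualClosure.1 hm (c ∘ₗ f) fun y hy => by simp [LinearMap.mem_ker.1 hy]

/-- Cokernels among reflexive modules: the closure in a free module of the image of a free
approximation of the cokernel. -/
theorem exists_reflexive_cokernel [IsNoetherianRing Λ] [IsNoetherianRing Λᵐᵒᵖ]
    (h₁ : EvalKernelHasZeroDual Λ) (h₂ : ExtendsFromDense Λ) (h₃ : BidualPreservesInjections Λ)
    [Module.Finite Λ M] (N : Submodule Λ M) :
    ∃ (C : ModuleCat.{u} Λ) (c : M →ₗ[Λ] C), IsReflexiveModule Λ C ∧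
      LinearMap.ker c = N.dualClosure ∧ ∀ (Z : Type u) [AddCommGroup Z] [Module Λ Z],
        IsReflexiveModule Λ Z → ∀ g : M →ₗ[Λ] Z, N ≤ LinearMap.ker g →
          ∃! f : C →ₗ[Λ] Z, f ∘ₗ c = g := by
  obtain ⟨n, a, ha⟩ := exists_free_approximation Λ (M ⧸ N)
  have hker := ker_free_approximation a ha
  set L := (LinearMap.range a).dualClosure
  have hL : IsReflexiveModule Λ L :=
    h₃.isReflexiveModule_of_dualClosure_le (isReflexiveModule_pi n) _ (Submodule.dualClosure_idem _)
  have := hL.1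
  have hD : IsDenseSubmodule ((LinearMap.range a).comap L.subtype) :=
    h₁.isDenseSubmodule_dualClosure _
  let c : M →ₗ[Λ] L := (a ∘ₗ N.mkQ).codRestrict L fun x => Submodule.le_dualClosure _ ⟨_, rfl⟩
  have hc : LinearMap.range c = (LinearMap.range a).comap L.subtype := by
    ext x
    constructor
    · rintro ⟨y, rfl⟩
      exact ⟨_, rfl⟩
    · rintro ⟨y, hy⟩
      obtain ⟨y, rfl⟩ := N.mkQ_surjective y
      exact ⟨y, Subtype.ext hy⟩
  have hcker : LinearMap.ker c = N.dualClosure := by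
    rw [LinearMap.ker_codRestrict, LinearMap.ker_comp, hker]
    rfl
  refine ⟨ModuleCat.of Λ L, c, hL, hcker, fun Z _ _ hZ g hg => ?_⟩
  rw [← hc] at hD
  obtain ⟨g', hg'⟩ := exists_comp_eq_of_ker_le (S := LinearMap.range c)
    c.rangeRestrict c.surjective_rangeRestrict g (by
    rw [LinearMap.ker_rangeRestrict, hcker]
    intro x hx
    exact eq_zero_of_forall_dual_eq_zero hZ.2.1 fun e =>
      Submodule.mem_dualClosure.1 hx (e ∘ₗ g) fun y hy => by simp [LinearMap.mem_ker.1 (hg hy)])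
  obtain ⟨f, hf⟩ := h₂.exists_extension hD hZ g'
  have hfc : f ∘ₗ c = g := by
    rw [← hg', ← hf]
    rfl
  refine ⟨f, hfc, fun f' hf' => hD.eq_of_eqOn hZ ?_⟩
  rintro _ ⟨x, rfl⟩
  exact (LinearMap.congr_fun hf' x).trans (LinearMap.congr_fun hfc x).symm

/-- A reflexive submodule of a reflexive module is closed: the identity extends to a retraction of
the closure, whose kernel has zero dual and hence vanishes. -/
theorem dualClosure_range_le [IsNoetherianRing Λ] [IsNoetherianRing Λᵐᵒᵖ]
    (h₁ : EvalKernelHasZeroDual Λ) (h₂ : ExtendsFromDense Λ) {A : Type u} [AddCommGroup A]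
    [Module Λ A] (hA : IsReflexiveModule Λ A) (hM : IsReflexiveModule Λ M) (f : A →ₗ[Λ] M)
    (hf : Function.Injective f) : (LinearMap.range f).dualClosure ≤ LinearMap.range f := by
  set L := (LinearMap.range f).dualClosure
  have := hM.1
  have hD : IsDenseSubmodule ((LinearMap.range f).comap L.subtype) :=
    h₁.isDenseSubmodule_dualClosure _
  obtain ⟨g, hg⟩ := exists_lift_of_range_le f hf
    (L.subtype ∘ₗ ((LinearMap.range f).comap L.subtype).subtype) (by
      rintro _ ⟨x, rfl⟩
      exact x.2)
  obtain ⟨r, rfl⟩ := h₂.exists_extension hD hA g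
  -- `f ∘ r` and the inclusion agree on a dense submodule
  have hr : f ∘ₗ r = L.subtype := hD.eq_of_eqOn hM fun x hx => LinearMap.congr_fun hg ⟨x, hx⟩
  exact fun x hx => ⟨r ⟨x, hx⟩, LinearMap.congr_fun hr ⟨x, hx⟩⟩

end Closed

/-! ### The category of reflexive modules -/

section Category

open Limits

/-! The statements about abelian categories used below avoid zero morphisms: the preadditive
structure of an abelian structure on `refl Λ` is not assumed to be the evident one. -/

theorem exists_epi_comp_equalizer {C : Type*} [Category C] [Abelian C] {X Y : C} (f : X ⟶ Y) :
    ∃ (J : C) (e : X ⟶ J) (i : J ⟶ Y), e ≫ i = f ∧ Epi e ∧ ∃ (Z : C) (g g' : Y ⟶ Z),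
      i ≫ g = i ≫ g' ∧ ∀ (W : C) (k : W ⟶ Y), k ≫ g = k ≫ g' → ∃ l : W ⟶ J, l ≫ i = k :=
  ⟨Abelian.image f, Abelian.factorThruImage f, Abelian.image.ι f, Abelian.image.fac f,
    inferInstance, cokernel f, cokernel.π f, 0, by simp, fun _ k hk =>
      ⟨kernel.lift _ k (by simpa using hk), kernel.lift_ι _ _ _⟩⟩

theorem exists_coequalizer_of_epi {C : Type*} [Category C] [Abelian C] {X Y : C} (f : X ⟶ Y)
    [Epi f] : ∃ (W : C) (g g' : W ⟶ X), g ≫ f = g' ≫ f ∧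
      ∀ (Z : C) (k : X ⟶ Z), g ≫ k = g' ≫ k → ∃ l : Y ⟶ Z, f ≫ l = k :=
  ⟨kernel f, kernel.ι f, 0, by simp, fun _ k hk =>
    ⟨Abelian.epiDesc f k (by simpa using hk), Abelian.comp_epiDesc _ _ _⟩⟩

variable {Λ : Type u} [Ring Λ]

namespace ReflCat

/-- The homomorphism of modules underlying a morphism of `refl Λ`. -/
abbrev lin {A B : ReflCat Λ} (f : A ⟶ B) : A.obj →ₗ[Λ] B.obj :=
  f.hom.hom

/-- The morphism of `refl Λ` given by a homomorphism of modules. -/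
abbrev ofLin {A B : ReflCat Λ} (f : A.obj →ₗ[Λ] B.obj) : A ⟶ B :=
  ObjectProperty.homMk (ModuleCat.ofHom f)

/-- A reflexive module as an object of `refl Λ`. -/
abbrev of {M : Type u} [AddCommGroup M] [Module Λ M] (h : IsReflexiveModule Λ M) : ReflCat Λ :=
  ⟨ModuleCat.of Λ M, h⟩

variable (Λ) in
/-- The free module `Λⁿ` as an object of `refl Λ`. -/
abbrev free (n : ℕ) : ReflCat Λ :=
  of (isReflexiveModule_pi (Λ := Λ) n)

theorem ext_lin {A B : ReflCat Λ} {f g : A ⟶ B} (h : lin f = lin g) : f = g :=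
  ObjectProperty.hom_ext _ (ModuleCat.hom_ext h)

/-- The morphism `Λ → A` that sends `1` to `x`. -/
abbrev point {A : ReflCat Λ} (x : A.obj) : free Λ 1 ⟶ A :=
  ofLin ((LinearMap.toSpanSingleton Λ A.obj x) ∘ₗ LinearMap.proj (0 : Fin 1))

theorem lin_point_one {A : ReflCat Λ} (x : A.obj) :
    lin (point x) (fun _ => 1) = x :=
  one_smul Λ x

theorem injective_of_mono {A B : ReflCat Λ} (f : A ⟶ B) [Mono f] :
    Function.Injective (lin f) := by
  intro x y hxy
  have : point x = point y := by
    rw [← cancel_mono f]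
    apply ext_lin
    refine LinearMap.ext fun (v : Fin 1 → Λ) => ?_
    change lin f (v 0 • x) = lin f (v 0 • y)
    rw [map_smul, map_smul, hxy]
  rw [← lin_point_one x, this, lin_point_one]

theorem mono_of_injective {A B : ReflCat Λ} (f : A ⟶ B) (h : Function.Injective (lin f)) :
    Mono f where
  right_cancellation u v huv := by
    apply ext_lin
    ext x
    exact h (LinearMap.congr_fun (congrArg lin huv) x)

theorem dense_range_of_epi {A B : ReflCat Λ} (f : A ⟶ B) [Epi f] :
    IsDenseSubmodule (LinearMap.range (lin f)) := by
  intro c hc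
  have : (ofLin (LinearMap.pi fun _ => c) : B ⟶ free Λ 1) = ofLin 0 := by
    rw [← cancel_epi f]
    apply ext_lin
    ext x i
    exact hc ⟨x, rfl⟩
  ext x
  exact congrFun (LinearMap.congr_fun (congrArg lin this) x) 0

theorem epi_of_dense_range {A B : ReflCat Λ} (f : A ⟶ B)
    (h : IsDenseSubmodule (LinearMap.range (lin f))) : Epi f where
  left_cancellation {Z} u v huv := by
    apply ext_lin
    refine h.eq_of_eqOn Z.property ?_
    rintro _ ⟨x, rfl⟩
    exact LinearMap.congr_fun (congrArg lin huv) x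

/-! ### Abelianness implies the torsion conditions -/

theorem exists_lin_range_eq [IsNoetherianRing Λ] {n : ℕ} (N : Submodule Λ (Fin n → Λ)) :
    ∃ (m : ℕ) (f : free Λ m ⟶ free Λ n), LinearMap.range (lin f) = N := by
  obtain ⟨m, p, hp⟩ := Module.Finite.exists_fin' Λ N
  refine ⟨m, ofLin (N.subtype ∘ₗ p), ?_⟩
  change LinearMap.range (N.subtype ∘ₗ p) = N
  rw [LinearMap.range_comp_of_range_eq_top _ (LinearMap.range_eq_top.2 hp), N.range_subtype]

/-- The range of an equalizer is closed. -/
theorem dualClosure_range_le_of_equalizer {A B Z : ReflCat Λ} (i : A ⟶ B) (g g' : B ⟶ Z)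
    (h : i ≫ g = i ≫ g')
    (hlift : ∀ (W : ReflCat Λ) (k : W ⟶ B), k ≫ g = k ≫ g' → ∃ l : W ⟶ A, l ≫ i = k) :
    (LinearMap.range (lin i)).dualClosure ≤ LinearMap.range (lin i) := by
  intro x hx
  rw [Submodule.mem_dualClosure] at hx
  have hi : ∀ y, lin g (lin i y) = lin g' (lin i y) :=
    fun y => LinearMap.congr_fun (congrArg lin h) y
  have hgx : (lin g - lin g') x = 0 :=
    eq_zero_of_forall_dual_eq_zero Z.property.2.1 fun c => hx (c ∘ₗ (lin g - lin g')) (by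
      rintro _ ⟨y, rfl⟩
      simp [hi y])
  obtain ⟨l, hl⟩ := hlift _ (point x) (ext_lin (by
    refine LinearMap.ext fun (v : Fin 1 → Λ) => ?_
    change lin g (v 0 • x) = lin g' (v 0 • x)
    rw [map_smul, map_smul, sub_eq_zero.1 hgx]))
  rw [← lin_point_one x, ← hl]
  exact ⟨_, rfl⟩

/-- For a presentation `M = Λⁿ / I`, the image of `Λᵐ → Λⁿ` with range `I`, taken in an abelian
category `refl Λ`, is the closure `J` of `I`, and `Λᵐ → J` is an epimorphism. So `J / I`, the kernel
of `M → M^**`, has zero dual. -/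
theorem evalKernelHasZeroDual [IsNoetherianRing Λ] [Abelian (ReflCat Λ)] :
    EvalKernelHasZeroDual Λ := by
  intro M _ _ _ f
  obtain ⟨n, p, hp⟩ := Module.Finite.exists_fin' Λ M
  obtain ⟨m, r, hr⟩ := exists_lin_range_eq (LinearMap.ker p)
  obtain ⟨J, e, i, hr', _, Z, c, c', hc, hlift⟩ := exists_epi_comp_equalizer r
  have hei : ∀ x, lin i (lin e x) = lin r x := fun x =>
    LinearMap.congr_fun (congrArg lin hr') x
  have he : IsDenseSubmodule (LinearMap.range (lin e)) := dense_range_of_epi e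
  have hi := dualClosure_range_le_of_equalizer i c c' hc hlift
  have hle : LinearMap.ker p ≤ LinearMap.range (lin i) := by
    rw [← hr]
    rintro _ ⟨x, rfl⟩
    exact ⟨lin e x, hei x⟩
  let q : J.obj →ₗ[Λ] LinearMap.ker (evalDoubleDual Λ M) :=
    (p ∘ₗ lin i).codRestrict _ fun x => mem_ker_evalDoubleDual.2 fun c =>
      LinearMap.congr_fun (he (c ∘ₗ p ∘ₗ lin i) (by
        rintro _ ⟨y, rfl⟩
        have : lin r y ∈ LinearMap.ker p := hr ▸ ⟨y, rfl⟩
        simp [hei, LinearMap.mem_ker.1 this])) x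
  have hfq : f ∘ₗ q = 0 := he _ (by
    rintro _ ⟨y, rfl⟩
    have h1 : lin r y ∈ LinearMap.ker p := hr ▸ ⟨y, rfl⟩
    have h2 : q (lin e y) = 0 := Subtype.ext (by
      change p (lin i (lin e y)) = 0
      rw [hei]
      exact h1)
    simp [h2])
  ext ⟨x, hx⟩
  obtain ⟨z, rfl⟩ := hp x
  rw [mem_ker_evalDoubleDual] at hx
  obtain ⟨y, rfl⟩ := hi (Submodule.mem_dualClosure.2 fun g hg => by
    obtain ⟨g', rfl⟩ := exists_comp_eq_of_ker_le p hp g (hle.trans hg)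
    exact hx g')
  exact LinearMap.congr_fun hfq y

/-- For a presentation `M = Λⁿ / K` and `I` the preimage of a dense submodule `N`, a homomorphism
`Λᵐ → Λⁿ` with range `I` is an epimorphism of `refl Λ`. In an abelian category it is the cokernel
of its kernel, so functionals on `I` extend to `Λⁿ`. -/
theorem extendsFromDense [IsNoetherianRing Λ] [Abelian (ReflCat Λ)] : ExtendsFromDense Λ := by
  intro M _ _ _ N hN g
  obtain ⟨n, p, hp⟩ := Module.Finite.exists_fin' Λ M
  obtain ⟨m, r, hr⟩ := exists_lin_range_eq (N.comap p)
  have hker : LinearMap.ker p ≤ N.comap p := fun x hx => by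
    simp [LinearMap.mem_ker.1 hx]
  have : Epi r := epi_of_dense_range r (by
    rw [hr]
    intro c hc
    obtain ⟨c', rfl⟩ := exists_comp_eq_of_ker_le p hp c (hker.trans hc)
    rw [hN c' (fun x hx => by
      obtain ⟨y, rfl⟩ := hp x
      exact hc hx), LinearMap.zero_comp])
  have hrN : ∀ x, p (lin r x) ∈ N := fun x => by
    have : lin r x ∈ N.comap p := hr ▸ ⟨x, rfl⟩
    exact this
  let g' : (free Λ m).obj →ₗ[Λ] Λ := g ∘ₗ (p ∘ₗ lin r).codRestrict N hrN
  obtain ⟨W, c, c', hc, hdesc⟩ := exists_coequalizer_of_epi r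
  have hc' : ∀ x, lin r (lin c x) = lin r (lin c' x) :=
    fun x => LinearMap.congr_fun (congrArg lin hc) x
  obtain ⟨l, hl⟩ := hdesc _ (ofLin (LinearMap.pi fun _ => g') : free Λ m ⟶ free Λ 1) (ext_lin (by
    ext x i
    change g ⟨p (lin r (lin c x)), _⟩ = g ⟨p (lin r (lin c' x)), _⟩
    simp only [hc']))
  have hl' : ∀ x, lin l (lin r x) 0 = g ⟨p (lin r x), hrN x⟩ := fun x =>
    congrFun (LinearMap.congr_fun (congrArg lin hl) x) 0
  obtain ⟨h, hh⟩ := exists_comp_eq_of_ker_le p hp (LinearMap.proj 0 ∘ₗ lin l) (fun z hz => by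
    obtain ⟨x, rfl⟩ : z ∈ LinearMap.range (lin r) := hr ▸ hker hz
    change lin l (lin r x) 0 = 0
    rw [hl']
    convert map_zero g
    exact hz)
  refine ⟨h, ?_⟩
  ext ⟨y, hy⟩
  obtain ⟨z, rfl⟩ := hp y
  obtain ⟨x, rfl⟩ : z ∈ LinearMap.range (lin r) := hr ▸ hy
  exact (LinearMap.congr_fun hh (lin r x)).trans (hl' x)

/-! ### The torsion conditions imply abelianness -/

theorem hasFiniteProducts : HasFiniteProducts (ReflCat Λ) := by
  have : HasTerminal (ReflCat Λ) := by
    have : ∀ A : ReflCat Λ, Unique (A ⟶ free Λ 0) := fun A =>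
      { default := ofLin 0
        uniq := fun f => ext_lin (by
          ext x i
          exact i.elim0) }
    exact hasTerminal_of_unique (free Λ 0)
  have : ∀ A B : ReflCat Λ, HasLimit (pair A B) := fun A B => ⟨⟨
    { cone := BinaryFan.mk (P := of (isReflexiveModule_prod A.property B.property))
        (ofLin (LinearMap.fst Λ A.obj B.obj)) (ofLin (LinearMap.snd Λ A.obj B.obj))
      isLimit := BinaryFan.IsLimit.mk _ (fun f g => ofLin ((lin f).prod (lin g)))
        (fun _ _ => rfl) (fun _ _ => rfl) (fun f g m hf hg => ext_lin (by
          subst hf hg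
          rfl)) }⟩⟩
  have := hasBinaryProducts_of_hasLimit_pair (ReflCat Λ)
  exact hasFiniteProducts_of_has_binary_and_terminal

/-- Kernels of modules are kernels in `refl Λ`. -/
def isLimitKernelFork {A B : ReflCat Λ} (f : A ⟶ B)
    (h : IsReflexiveModule Λ (LinearMap.ker (lin f))) :
    IsLimit (KernelFork.ofι (f := f) (ofLin (LinearMap.ker (lin f)).subtype : of h ⟶ A)
      (ext_lin (LinearMap.ext fun x => x.2))) :=
  have : Mono (ofLin (LinearMap.ker (lin f)).subtype : of h ⟶ A) :=
    mono_of_injective _ (Submodule.subtype_injective _)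
  KernelFork.IsLimit.ofι' _ _ fun k hk =>
    ⟨ofLin ((lin k).codRestrict _ fun x => LinearMap.congr_fun (congrArg lin hk) x), rfl⟩

theorem nonempty_abelian [IsNoetherianRing Λ] [IsNoetherianRing Λᵐᵒᵖ]
    (h₁ : EvalKernelHasZeroDual Λ) (h₂ : ExtendsFromDense Λ) (h₃ : BidualPreservesInjections Λ) :
    Nonempty (Abelian (ReflCat Λ)) := by
  have := hasFiniteProducts (Λ := Λ)
  have hker : ∀ {A B : ReflCat Λ} (f : A ⟶ B), IsReflexiveModule Λ (LinearMap.ker (lin f)) :=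
    fun {A B} f => h₃.isReflexiveModule_ker A.property B.property (lin f)
  have hcoker : ∀ {A B : ReflCat Λ} (f : A ⟶ B), ∃ (C : ReflCat Λ) (c : B ⟶ C) (w : f ≫ c = 0),
      LinearMap.ker (lin c) = (LinearMap.range (lin f)).dualClosure ∧
      Nonempty (IsColimit (CokernelCofork.ofπ c w)) := by
    intro A B f
    have := B.property.1
    obtain ⟨C, c, hC, hc, huniv⟩ := exists_reflexive_cokernel h₁ h₂ h₃ (LinearMap.range (lin f))
    have w : f ≫ (ofLin c : B ⟶ ⟨C, hC⟩) = 0 := ext_lin (by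
      ext x
      have : lin f x ∈ LinearMap.ker c := hc ▸ Submodule.le_dualClosure _ ⟨x, rfl⟩
      exact this)
    have key : ∀ {Z : ReflCat Λ} (g : B ⟶ Z), f ≫ g = 0 →
        ∃! l : C →ₗ[Λ] Z.obj, l ∘ₗ c = lin g := fun {Z} g hg =>
      huniv Z.obj Z.property (lin g) (by
        rintro _ ⟨x, rfl⟩
        exact LinearMap.congr_fun (congrArg lin hg) x)
    refine ⟨⟨C, hC⟩, ofLin c, w, hc, ⟨CokernelCofork.IsColimit.ofπ _ _
      (fun g hg => ofLin (key g hg).choose) (fun g hg => ext_lin (key g hg).choose_spec.1)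
      (fun g hg m hm => ext_lin ((key g hg).choose_spec.2 _ (congrArg lin hm)))⟩⟩
  have : HasKernels (ReflCat Λ) := ⟨fun f => ⟨⟨⟨_, isLimitKernelFork f (hker f)⟩⟩⟩⟩
  have : HasCokernels (ReflCat Λ) := ⟨fun f => by
    obtain ⟨C, c, w, -, ⟨hc⟩⟩ := hcoker f
    exact ⟨⟨⟨_, hc⟩⟩⟩⟩
  have : IsNormalMonoCategory (ReflCat Λ) := ⟨fun {A B} f _ => by
    obtain ⟨C, c, w, hc, -⟩ := hcoker f
    have hf := injective_of_mono f
    have hcl := dualClosure_range_le h₁ h₂ A.property B.property (lin f) hf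
    refine ⟨⟨C, c, w, KernelFork.IsLimit.ofι' _ _ fun k hk => ?_⟩⟩
    have hl := exists_lift_of_range_le (lin f) hf (lin k) (by
      refine le_trans ?_ hcl
      rw [← hc]
      rintro _ ⟨x, rfl⟩
      exact LinearMap.congr_fun (congrArg lin hk) x)
    exact ⟨ofLin hl.choose, ext_lin hl.choose_spec⟩⟩
  have : IsNormalEpiCategory (ReflCat Λ) := ⟨fun {A B} f _ => by
    have hd := dense_range_of_epi f
    have := B.property.1
    refine ⟨⟨of (hker f), ofLin (LinearMap.ker (lin f)).subtype,
      ext_lin (LinearMap.ext fun x => x.2), CokernelCofork.IsColimit.ofπ' _ _ fun {Z} k hk => ?_⟩⟩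
    have hl : ∃ l : B.obj →ₗ[Λ] Z.obj, l ∘ₗ lin f = lin k := by
      obtain ⟨g, hg⟩ := exists_comp_eq_of_ker_le (S := LinearMap.range (lin f))
        (lin f).rangeRestrict (lin f).surjective_rangeRestrict (lin k) (by
          rw [LinearMap.ker_rangeRestrict]
          exact fun x hx => LinearMap.congr_fun (congrArg lin hk) ⟨x, hx⟩)
      obtain ⟨l, hl⟩ := h₂.exists_extension hd Z.property g
      refine ⟨l, ?_⟩
      rw [← hg, ← hl]
      rfl
    exact ⟨ofLin hl.choose, ext_lin hl.choose_spec⟩⟩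
  exact ⟨Abelian.mk⟩

end ReflCat

end Category

/-! ### Flat dimension and dominant dimension -/

section Dimension

variable {Λ : Type u} [Ring Λ]

theorem FactorsThroughFree.of_equiv {E F : Type u} [AddCommGroup E] [Module Λ E] [AddCommGroup F]
    [Module Λ F] (h : FactorsThroughFree Λ E) (e : E ≃ₗ[Λ] F) : FactorsThroughFree Λ F := by
  intro M _ _ _ v
  obtain ⟨n, a, b, hab⟩ := h M (e.symm.toLinearMap ∘ₗ v)
  refine ⟨n, a, e.toLinearMap ∘ₗ b, ?_⟩
  rw [LinearMap.comp_assoc, hab]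
  ext x
  simp

theorem hasFlatDimLT_one_of_isFlatModule {E : ModuleCat.{u} Λ} (h : IsFlatModule Λ E) :
    HasFlatDimLT Λ 1 E :=
  ⟨ModuleCat.of Λ PUnit, E, 0, LinearMap.id, h, fun _ _ _ => rfl, fun _ =>
    ⟨fun hx => ⟨0, hx.symm⟩, fun ⟨_, hy⟩ => hy.symm⟩, Function.surjective_id,
    inferInstanceAs (Subsingleton PUnit)⟩

theorem isFlatModule_of_hasFlatDimLT_one [IsNoetherianRing Λ] {E : ModuleCat.{u} Λ}
    (h : HasFlatDimLT Λ 1 E) : IsFlatModule Λ E := by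
  obtain ⟨K, F, i, p, hF, -, hex, hp, hK⟩ := h
  have : Subsingleton K := hK
  have hpi : Function.Injective p := by
    rw [injective_iff_map_eq_zero]
    intro x hx
    obtain ⟨y, rfl⟩ := (hex x).1 hx
    rw [Subsingleton.elim y 0, map_zero]
  exact (hF.factorsThroughFree.of_equiv (LinearEquiv.ofBijective p ⟨hpi, hp⟩)).isFlatModule

theorem auslanderCondition_one_iff [IsNoetherianRing Λ] (n : ℕ) : AuslanderCondition Λ 1 n ↔
    ∃ R : MinimalInjectiveResolution Λ Λ, ∀ i < n, IsFlatModule Λ (R.I i) :=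
  exists_congr fun _ => forall₂_congr fun _ _ =>
    ⟨isFlatModule_of_hasFlatDimLT_one, hasFlatDimLT_one_of_isFlatModule⟩

theorem le_dominantDimension_iff (n : ℕ) : (n : ℕ∞) ≤ dominantDimension Λ ↔
    ∃ R : MinimalInjectiveResolution Λ Λ, ∀ i < n, IsFlatModule Λ (R.I i) := by
  constructor
  · intro h
    by_contra! hn
    cases n with
    | zero =>
      obtain ⟨R⟩ := nonempty_minimalInjectiveResolution Λ Λ
      obtain ⟨i, hi, -⟩ := hn R
      exact absurd hi (Nat.not_lt_zero i)
    | succ n =>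
      -- no resolution is flat in the first `n + 1` degrees, so the supremum is at most `n`
      have hle : dominantDimension Λ ≤ n := by
        refine sSup_le ?_
        rintro _ ⟨k, rfl, R, hR⟩
        by_contra! hk
        obtain ⟨i, hi, hni⟩ := hn R
        have hk' : n < k := by exact_mod_cast hk
        exact hni (hR i (by omega))
      have := h.trans hle
      norm_cast at this
      omega
  · rintro ⟨R, hR⟩
    exact le_sSup ⟨n, rfl, R, hR⟩

end Dimension

theorem mainTheorem3 (Λ : Type u) [Ring Λ] [IsNoetherianRing Λ] [IsNoetherianRing Λᵐᵒᵖ] :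
    (Nonempty (Abelian (ReflCat Λ)) ↔ AuslanderCondition Λ 1 2) ∧
      (AuslanderCondition Λ 1 2 ↔ 2 ≤ dominantDimension Λ) := by
  refine ⟨?_, (auslanderCondition_one_iff 2).trans (le_dominantDimension_iff 2).symm⟩
  rw [auslanderCondition_one_iff]
  constructor
  · rintro ⟨_⟩
    have h₁ : EvalKernelHasZeroDual Λ := ReflCat.evalKernelHasZeroDual
    have h₂ : ExtendsFromDense Λ := ReflCat.extendsFromDense
    obtain ⟨R⟩ := nonempty_minimalInjectiveResolution Λ Λ
    refine ⟨R, fun i hi => (h₁.factorsThroughFree (R.injective i) ?_).isFlatModule⟩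
    intro T _ _ _ hT v
    interval_cases i
    · exact h₂.hom_zero_eq_zero R hT v
    · exact h₂.hom_one_eq_zero R hT v
  · rintro ⟨R, hR⟩
    have h0 := (hR 0 (by norm_num)).factorsThroughFree
    have h1 := (hR 1 (by norm_num)).factorsThroughFree
    exact ReflCat.nonempty_abelian (evalKernelHasZeroDual_of_factorsThroughFree R h0)
      (extendsFromDense_of_factorsThroughFree R h1)
      (bidualPreservesInjections_of_factorsThroughFree (R.injective 0) R.ι R.ι_injective h0)
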